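/- **Notation.** For a symmetric positive semidefinite matrix $M$ put $\|v\|_M^2=v^\top Mv$; $\preceq,\prec$ denote the Loewner order, $M^{1/2}$ the positive semidefinite square root, $\otimes$ the Kronecker product. $\mathrm{unvec}$ is the inverse of column-stacking vectorization, and $e_i$ is the $i$-th standard unit vector. **System.** Consider $x_{t+1}=A(\vartheta)x_t+B(\vartheta)u_t+Ew_t$, $y_t=Cx_t+v_t$ with $[A(\vartheta),B(\vartheta)]=[A_0,B_0]+E\,\mathrm{unvec}(J\vartheta+\vartheta_0)$, where $x_t\in\mathbb R^{n_x}$, $u_t\in\mathbb R^{n_u}$, $y_t\in\mathbb R^{n_y}$, $w_t\in\mathbb R^{n_w}$, $\vartheta\in\mathbb R^{n_\vartheta}$. Here $x_0\sim\mathcal N(\mu_{x,0},\Sigma_{x,0})$, $w_t\sim\mathcal N(0,Q^{\rm true})$ and $v_t\sim\mathcal N(0,R^{\rm true})$, $t\in\mathbb N$, are mutually independent and $Q^{\rm true},R^{\rm true}\succ0$. **Assumption 1.** Let $\hat\vartheta$ be an estimate, $\Sigma_\vartheta\succ0$, $\delta\in(0,1)$, let $\Sigma_{\vartheta,\delta}=\chi^2_{n_\vartheta}(\delta)\Sigma_\vartheta$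 with $\chi^2_{n_\vartheta}(\cdot)$ the quantile function of the chi-squared distribution with $n_\vartheta$ degrees of freedom, and let $\Theta_\delta=\{\vartheta : (\vartheta-\hat\vartheta)^\top\Sigma_{\vartheta,\delta}^{-1}(\vartheta-\hat\vartheta)\le1\}$. The true parameter satisfies $\vartheta\in\Theta_\delta$, and $Q\succeq Q^{\rm true}$, $R\succeq R^{\rm true}$ are known. **Closed loop.** Given $A_c,K,L$, the controller is $x^c_{t+1}=A_cx^c_t+Ly_t$, $x^c_0=0$, $u_t=Kx^c_t+\nu_t$, with $\nu_t$ specified below. Write $\hat A=A(\hat\vartheta)$, $\hat B=B(\hat\vartheta)$, $D_K=\mathrm{diag}(I,K)$, $\Delta(\vartheta)=I_{n_w}\otimes(\vartheta-\hat\vartheta)^\top$, let $J_\Delta$ be the matrix with $\Delta(\vartheta)J_\Delta=\mathrm{unvec}(J(\vartheta-\hat\vartheta))$ for all $\vartheta$, and $$\hat{\mathcal A}=\begin{bmatrix}\hat A&\hat BK\\LC&A_c\end{bmatrix},\ \mathcal B_p=\begin{bmatrix}E\\0\end{bmatrix},\ \mathcal B_d=\begin{bmatrix}EQ^{1/2}&0\\0&LR^{1/2}\end{bmatrix},\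 \mathcal C_q=J_\Delta D_K,\ \mathcal C_\epsilon=[C_\epsilon,\,D_\epsilon K],\ \hat{\mathcal B}_\nu=\begin{bmatrix}\hat B\\0\end{bmatrix},\ \mathcal A(\vartheta)=\hat{\mathcal A}+\mathcal B_p\Delta(\vartheta)\mathcal C_q .$$ The cost weights satisfy $[C_\epsilon,D_\epsilon]^\top[C_\epsilon,D_\epsilon]=\mathrm{diag}(Q_c,R_c)$ with $R_c\succ0$. Put $Q_{\xi,c}=\mathrm{diag}(Q_c,K^\top R_cK)$, $\mu_{\xi,0}=(\mu_{x,0},0)$. **Robust controller with bound $\gamma>0$.** There are $\mathcal X\succ0$, $\Lambda\succ0$ with $\mathrm{tr}(\mathcal C_\epsilon\mathcal X\mathcal C_\epsilon^\top)\le\gamma^2$ and $$\begin{bmatrix}\hat{\mathcal A}\mathcal X\hat{\mathcal A}^\top-\mathcal X+\mathcal B_d\mathcal B_d^\top+\mathcal B_p\Lambda\mathcal B_p^\top&\hat{\mathcal A}\mathcal X\mathcal C_q^\top\\ \mathcal C_q\mathcal X\hat{\mathcal A}^\top&\mathcal C_q\mathcal X\mathcal C_q^\top-\Lambda\otimes\Sigma_{\vartheta,\delta}^{-1}\end{bmatrix}\prec0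 .$$ **Assumption 2.** $\mathcal P\succ0$, $\rho\in(0,1)$ and $\mathcal A(\vartheta)^\top\mathcal P\mathcal A(\vartheta)\preceq\rho^2\mathcal P$ for all $\vartheta\in\Theta_\delta$. **Constraint tightening.** Let $\bar\Sigma_{\xi,t}\succeq 0$, $t\in\mathbb N$, satisfy $\bar\Sigma_{\xi,0}=\mathrm{diag}(\Sigma_{x,0},0)$ and $\mathcal A(\vartheta)\bar\Sigma_{\xi,t}\mathcal A(\vartheta)^\top+\mathcal B_d\mathcal B_d^\top\preceq\bar\Sigma_{\xi,t+1}$ for all $t\in\mathbb N$, $\vartheta\in\Theta_\delta$. For $h_j\in\mathbb R^{n_x+n_u}$ and $p_j\in(0,1)$, $j=1,\dots,r$, let $c_{j,t}=\Phi^{-1}(p_j)\|\bar\Sigma_{\xi,t}^{1/2}D_K^\top h_j\|$, with $\Phi^{-1}$ the standard normal quantile function, and $f_j=\|\mathcal P^{-1/2}D_K^\top h_j\|$. Let $\Sigma_J=(I\otimes\mathcal P^{1/2}\mathcal B_p)J\Sigma_{\vartheta,\delta}J^\top(I\otimes\mathcal P^{1/2}\mathcal B_p)^\top$ and $\bar\Sigma_J=\sum_{i=1}^{2n_x}(I\otimes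 e_i)^\top\Sigma_J(I\otimes e_i)$. **MPC problem at time $t$**, with horizon $T\ge1$, terminal set $\Omega\subseteq\mathbb R^{2n_x}\times\mathbb R$ and terminal weight $S\succeq0$: minimize $$\sum_{i=0}^{T-1}\bigl(\|\bar\xi_{i|t}\|^2_{Q_{\xi,c}}+\|\nu_{i|t}\|^2_{R_c}\bigr)+\|\bar\xi_{T|t}\|_S^2$$ over $\nu_{\cdot|t},\bar\xi_{\cdot|t},\alpha_{\cdot|t}$, subject to, for $i=0,\dots,T-1$ and $j=1,\dots,r$ and with $z_{i|t}=D_K\bar\xi_{i|t}+(0,\nu_{i|t})$: $\ \bar\xi_{i+1|t}=\hat{\mathcal A}\bar\xi_{i|t}+\hat{\mathcal B}_\nu\nu_{i|t}$; $\ \alpha_{i+1|t}\ge\rho\alpha_{i|t}+\|\bar\Sigma_J^{1/2}z_{i|t}\|$; $\ h_j^\top z_{i|t}\le1-c_{j,t+i}-\alpha_{i|t}f_j$; $\ (\bar\xi_{T|t},\alpha_{T|t})\in\Omega$; and the initial condition $(\bar\xi_{0|t},\alpha_{0|t})=(\bar\xi^\star_{1|t-1},\alpha^\star_{1|t-1})$,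 respectively $(\bar\xi_{0|0},\alpha_{0|0})=(\mu_{\xi,0},0)$. Here $\star$ marks the (deterministic) optimal solution selected at the respective time, and $\nu_t=\nu^\star_{0|t}$ is applied. **Assumption 3.** $\Omega$ contains the origin in its interior, and for all $(\xi,\alpha)\in\Omega$: (a) $(\hat{\mathcal A}\xi,\ \rho\alpha+\|\bar\Sigma_J^{1/2}D_K\xi\|)\in\Omega$; (b) $h_j^\top D_K\xi\le1-c_{j,t}-\alpha f_j$ for all $t\in\mathbb N$ and all $j$; (c) $\|\hat{\mathcal A}\xi\|_S^2-\|\xi\|_S^2\le-\|\xi\|^2_{Q_{\xi,c}}$. **Theorem (Closed-loop guarantees).** Suppose that all of the above holds and that the MPC problem is feasible at $t=0$. Then: 1. (Recursive feasibility) For every $t\in\mathbb N$, if at each of the times $0,\dots,t-1$ an optimal solution of the MPC problem has been selected, then the MPC problem at time $t$ is feasible. 2. (Chance constraints) In the resulting closed loop (an optimal solution being selected at every time), for every $t\in\mathbb N$ and every $j$ with $p_j\ge\frac12$, $\ \Pr\bigl(h_j^\top\begin{bmatrix}x_t\\u_t\end{bmatrix}\le1\bigr)\ge p_j$. 3. (Average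 cost) In the resulting closed loop, $\|x_t\|_{Q_c}^2+\|u_t\|_{R_c}^2$ is integrable for every $t$, and the following limit exists and satisfies $$\lim_{N\to\infty}\frac1N\,\mathbb E\Bigl[\sum_{t=0}^{N-1}\|x_t\|_{Q_c}^2+\|u_t\|_{R_c}^2\Bigr]\le\gamma^2 .$$ -/

import Mathlib

open MeasureTheory ProbabilityTheory Filter Topology
open scoped Matrix Kronecker MatrixOrder

noncomputable section

namespace D2PC

/-- The quantile function of a probability distribution on the real line. -/
def quantile (μ : Measure ℝ) (p : ℝ) : ℝ := sInf {x : ℝ | p ≤ cdf μ x}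

/-- The chi-squared distribution with `n` degrees of freedom: the law of the sum of the squares of
`n` independent standard normal variables. -/
def chiSquared (n : ℕ) : Measure ℝ :=
  (Measure.pi fun _ : Fin n => gaussianReal 0 1).map fun x => ∑ i, x i ^ 2

/-- The quadratic form `‖v‖²_M = vᵀ M v`. -/
def quad {ι : Type*} [Fintype ι] (M : Matrix ι ι ℝ) (v : ι → ℝ) : ℝ := v ⬝ᵥ M *ᵥ v

/-- The weighted norm `‖v‖_M`. For positive semidefinite `M` it is the Euclidean norm of
`M^{1/2} v`, see `wnorm_eq_norm_sqrt`. -/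
def wnorm {ι : Type*} [Fintype ι] (M : Matrix ι ι ℝ) (v : ι → ℝ) : ℝ := √(quad M v)

theorem wnorm_eq_norm_sqrt {ι : Type*} [Fintype ι] [DecidableEq ι] {M : Matrix ι ι ℝ}
    (hM : M.PosSemidef) (v : ι → ℝ) :
    wnorm M v = ‖WithLp.toLp 2 (CFC.sqrt M *ᵥ v)‖ := by
  have hs : (CFC.sqrt M).IsHermitian := (Matrix.nonneg_iff_posSemidef.mp (CFC.sqrt_nonneg M)).isHermitian
  have h2 : CFC.sqrt M * CFC.sqrt M = M := CFC.sqrt_mul_sqrt_self M hM.nonneg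
  have hT : (CFC.sqrt M)ᵀ = CFC.sqrt M := by simpa using hs.eq
  rw [wnorm, quad, EuclideanSpace.norm_eq]
  congr 1
  have : (∑ i, ‖(WithLp.toLp 2 (CFC.sqrt M *ᵥ v)) i‖ ^ 2)
      = (CFC.sqrt M *ᵥ v) ⬝ᵥ (CFC.sqrt M *ᵥ v) := by
    simp [dotProduct, sq]
  rw [this]
  conv_lhs => rw [← h2]
  rw [← Matrix.mulVec_mulVec, Matrix.dotProduct_mulVec, ← Matrix.mulVec_transpose, hT]

/-- Inverse of the column-stacking vectorization: entry `(j, i)` of the vector is the entry of the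
matrix in column `j` and row `i`. -/
def unvec {m n : Type*} (x : n × m → ℝ) : Matrix m n ℝ := Matrix.of fun i j => x (j, i)

/-- All data of the controlled system and of the offline design. The dimensions are those of the
state, the input, the output, the disturbance, the unknown parameter, the performance output, and
the number of chance constraints. -/
structure Design (nx nu ny nw nθ nε r : ℕ) where
  /-- known part of the system matrices -/
  A₀ : Matrix (Fin nx) (Fin nx) ℝ
  B₀ : Matrix (Fin nx) (Fin nu) ℝ
  E : Matrix (Fin nx) (Fin nw) ℝ
  C : Matrix (Fin ny) (Fin nx) ℝ
  /-- affine parameterization of the vectorized unknown part; a row index `(j, i)` stands for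
  column `j` and row `i` of the unvectorized matrix -/
  J : Matrix ((Fin nx ⊕ Fin nu) × Fin nw) (Fin nθ) ℝ
  θ₀ : (Fin nx ⊕ Fin nu) × Fin nw → ℝ
  /-- parameter estimate, its covariance, and the confidence level -/
  θhat : Fin nθ → ℝ
  Sθ : Matrix (Fin nθ) (Fin nθ) ℝ
  δ : ℝ
  /-- the (over-)estimated covariances of the process and measurement noise -/
  Q : Matrix (Fin nw) (Fin nw) ℝ
  R : Matrix (Fin ny) (Fin ny) ℝ
  /-- mean and covariance of the initial state -/
  μx₀ : Fin nx → ℝ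
  Sx₀ : Matrix (Fin nx) (Fin nx) ℝ
  /-- robust dynamic output-feedback controller -/
  Ac : Matrix (Fin nx) (Fin nx) ℝ
  K : Matrix (Fin nu) (Fin nx) ℝ
  L : Matrix (Fin nx) (Fin ny) ℝ
  /-- performance output and weights of the quadratic cost -/
  Cε : Matrix (Fin nε) (Fin nx) ℝ
  Dε : Matrix (Fin nε) (Fin nu) ℝ
  Qc : Matrix (Fin nx) (Fin nx) ℝ
  Rc : Matrix (Fin nu) (Fin nu) ℝ
  /-- chance constraints and their probability levels -/
  h : Fin r → Fin nx ⊕ Fin nu → ℝ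
  p : Fin r → ℝ
  /-- tube shape and contraction rate -/
  P : Matrix (Fin nx ⊕ Fin nx) (Fin nx ⊕ Fin nx) ℝ
  ρ : ℝ
  /-- bounds for the covariance of the stochastic error -/
  Sbar : ℕ → Matrix (Fin nx ⊕ Fin nx) (Fin nx ⊕ Fin nx) ℝ
  /-- horizon, terminal set and terminal weight of the MPC problem -/
  T : ℕ
  Ω : Set ((Fin nx ⊕ Fin nx → ℝ) × ℝ)
  S : Matrix (Fin nx ⊕ Fin nx) (Fin nx ⊕ Fin nx) ℝ

/-- Decision variables of the MPC problem: inputs `ν 0, …, ν (T-1)`, nominal predictions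
`ξ 0, …, ξ T` and tube scalings `α 0, …, α T`. Neither the constraints nor the cost involve the
values at larger indices. -/
structure MPCVars (nx nu : ℕ) where
  ν : ℕ → Fin nu → ℝ
  ξ : ℕ → Fin nx ⊕ Fin nx → ℝ
  α : ℕ → ℝ

namespace Design

variable {nx nu ny nw nθ nε r : ℕ} (D : Design nx nu ny nw nθ nε r)

/-! ### The uncertain system -/

/-- `[A(ϑ), B(ϑ)]`. -/
def sysMat (θ : Fin nθ → ℝ) : Matrix (Fin nx) (Fin nx ⊕ Fin nu) ℝ :=
  Matrix.fromCols D.A₀ D.B₀ + D.E * unvec (D.J *ᵥ θ + D.θ₀)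

def A (θ : Fin nθ → ℝ) : Matrix (Fin nx) (Fin nx) ℝ := (D.sysMat θ).toCols₁

def B (θ : Fin nθ → ℝ) : Matrix (Fin nx) (Fin nu) ℝ := (D.sysMat θ).toCols₂

/-- `Σ_{ϑ,δ}`. -/
def Sθδ : Matrix (Fin nθ) (Fin nθ) ℝ := quantile (chiSquared nθ) D.δ • D.Sθ

/-- The confidence ellipsoid `Θ_δ`. -/
def Θδ : Set (Fin nθ → ℝ) := {θ | quad D.Sθδ⁻¹ (θ - D.θhat) ≤ 1}

/-! ### Linear fractional representation and closed-loop matrices -/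

/-- `Δ = I ⊗ (ϑ - ϑ̂)ᵀ`. -/
def Δ (θ : Fin nθ → ℝ) : Matrix (Fin nw) (Fin nw × Fin nθ) ℝ :=
  Matrix.of fun i k => (1 : Matrix (Fin nw) (Fin nw) ℝ) i k.1 * (θ - D.θhat) k.2

/-- The matrix `J_Δ`, a rearrangement of the entries of `J` for which `Δ * J_Δ` is the
unvectorization of `J (ϑ - ϑ̂)`, see `sysMat_eq`. -/
def JΔ : Matrix (Fin nw × Fin nθ) (Fin nx ⊕ Fin nu) ℝ :=
  Matrix.of fun k j => D.J (j, k.1) k.2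

/-- `diag(I, K)`, which maps the augmented state `(x, xᶜ)` to `(x, K xᶜ)`. -/
def diagIK : Matrix (Fin nx ⊕ Fin nu) (Fin nx ⊕ Fin nx) ℝ := Matrix.fromBlocks 1 0 0 D.K

def calAhat : Matrix (Fin nx ⊕ Fin nx) (Fin nx ⊕ Fin nx) ℝ :=
  Matrix.fromBlocks (D.A D.θhat) (D.B D.θhat * D.K) (D.L * D.C) D.Ac

def calBp : Matrix (Fin nx ⊕ Fin nx) (Fin nw) ℝ := Matrix.fromRows D.E 0

def calBd : Matrix (Fin nx ⊕ Fin nx) (Fin nw ⊕ Fin ny) ℝ :=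
  Matrix.fromBlocks (D.E * CFC.sqrt D.Q) 0 0 (D.L * CFC.sqrt D.R)

def calCq : Matrix (Fin nw × Fin nθ) (Fin nx ⊕ Fin nx) ℝ := D.JΔ * D.diagIK

def calCε : Matrix (Fin nε) (Fin nx ⊕ Fin nx) ℝ := Matrix.fromCols D.Cε (D.Dε * D.K)

def calBνhat : Matrix (Fin nx ⊕ Fin nx) (Fin nu) ℝ := Matrix.fromRows (D.B D.θhat) 0

/-- The closed-loop matrix `𝒜(ϑ)`. -/
def calA (θ : Fin nθ → ℝ) : Matrix (Fin nx ⊕ Fin nx) (Fin nx ⊕ Fin nx) ℝ :=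
  D.calAhat + D.calBp * D.Δ θ * D.calCq

theorem sysMat_eq (θ : Fin nθ → ℝ) :
    D.sysMat θ = D.sysMat D.θhat + D.E * (D.Δ θ * D.JΔ) := by
  have h : D.Δ θ * D.JΔ = unvec (D.J *ᵥ (θ - D.θhat)) := by
    ext i j
    simp [Matrix.mul_apply, Δ, JΔ, unvec, Fintype.sum_prod_type, Matrix.one_apply,
      Matrix.mulVec, dotProduct, mul_comm]
  have h' : unvec (D.J *ᵥ θ + D.θ₀)
      = unvec (D.J *ᵥ D.θhat + D.θ₀) + unvec (D.J *ᵥ (θ - D.θhat)) := by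
    ext i j
    simp [unvec, Matrix.mulVec_sub]
    ring
  rw [h, sysMat, sysMat, h', Matrix.mul_add, add_assoc]

/-- `𝒜(ϑ)` is the state matrix of the interconnection of plant and robust controller. -/
theorem calA_eq (θ : Fin nθ → ℝ) :
    D.calA θ = Matrix.fromBlocks (D.A θ) (D.B θ * D.K) (D.L * D.C) D.Ac := by
  set M := D.E * (D.Δ θ * D.JΔ) with hM
  have hA : D.A θ = D.A D.θhat + M.toCols₁ := by
    rw [A, sysMat_eq]; rfl
  have hB : D.B θ = D.B D.θhat + M.toCols₂ := by
    rw [B, sysMat_eq]; rfl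
  have h1 : D.calBp * D.Δ θ * D.calCq = Matrix.fromRows (M * D.diagIK) 0 := by
    rw [calBp, calCq, Matrix.mul_assoc, Matrix.fromRows_mul, Matrix.zero_mul, hM]
    simp only [Matrix.mul_assoc]
  have h2 : M * D.diagIK = Matrix.fromCols M.toCols₁ (M.toCols₂ * D.K) := by
    conv_lhs => rw [← Matrix.fromCols_toCols M]
    rw [diagIK, Matrix.fromCols_mul_fromBlocks]
    simp
  rw [calA, h1, h2, calAhat, hA, hB, Matrix.add_mul]
  ext (i | i) (j | j) <;> simp

/-! ### Standing conventions and assumptions -/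

/-- Conventions on the data that hold throughout. -/
structure Standing : Prop where
  δ_mem : D.δ ∈ Set.Ioo (0 : ℝ) 1
  Sθ_posDef : D.Sθ.PosDef
  Sx₀_posSemidef : D.Sx₀.PosSemidef
  Qc_eq : D.Cεᵀ * D.Cε = D.Qc
  cross_eq : D.Cεᵀ * D.Dε = 0
  Rc_eq : D.Dεᵀ * D.Dε = D.Rc
  Rc_posDef : D.Rc.PosDef
  p_mem : ∀ j, D.p j ∈ Set.Ioo (0 : ℝ) 1
  S_posSemidef : D.S.PosSemidef
  T_pos : 1 ≤ D.T

/-- The true parameter lies in the confidence ellipsoid, and the true (positive definite) noise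
covariances are over-estimated. -/
structure ParameterAssumption (θ : Fin nθ → ℝ) (Qtrue : Matrix (Fin nw) (Fin nw) ℝ)
    (Rtrue : Matrix (Fin ny) (Fin ny) ℝ) : Prop where
  mem : θ ∈ D.Θδ
  Qtrue_posDef : Qtrue.PosDef
  Rtrue_posDef : Rtrue.PosDef
  Q_le : (D.Q - Qtrue).PosSemidef
  R_le : (D.R - Rtrue).PosSemidef

/-- `𝒫` is a common Lyapunov function with contraction rate `ρ`. -/
structure TubeAssumption : Prop where
  P_posDef : D.P.PosDef
  ρ_mem : D.ρ ∈ Set.Ioo (0 : ℝ) 1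
  contraction : ∀ θ ∈ D.Θδ, (D.ρ ^ 2 • D.P - (D.calA θ)ᵀ * D.P * D.calA θ).PosSemidef

/-- Mean and covariance of the augmented initial state. -/
def μξ₀ : Fin nx ⊕ Fin nx → ℝ := Sum.elim D.μx₀ (0 : Fin nx → ℝ)

def Sξ₀ : Matrix (Fin nx ⊕ Fin nx) (Fin nx ⊕ Fin nx) ℝ := Matrix.fromBlocks D.Sx₀ 0 0 0

/-- `Sbar` is a sequence of covariance matrices bounding the error covariance robustly. -/
structure ErrorCovarianceBound : Prop where
  posSemidef : ∀ t, (D.Sbar t).PosSemidef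
  zero : D.Sbar 0 = D.Sξ₀
  succ : ∀ t, ∀ θ ∈ D.Θδ,
    (D.Sbar (t + 1) - (D.calA θ * D.Sbar t * (D.calA θ)ᵀ + D.calBd * D.calBdᵀ)).PosSemidef

/-- Outer and middle factor of the linear matrix inequality for robust performance; the block
columns of the outer factor are `(I, 𝒜̂ᵀ, 0, I)` and `(0, C_qᵀ, I, 0)`. -/
def lmiOuter : Matrix
    (((Fin nx ⊕ Fin nx) ⊕ (Fin nx ⊕ Fin nx)) ⊕ ((Fin nw × Fin nθ) ⊕ (Fin nx ⊕ Fin nx)))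
    ((Fin nx ⊕ Fin nx) ⊕ (Fin nw × Fin nθ)) ℝ :=
  Matrix.fromRows (Matrix.fromBlocks 1 0 D.calAhatᵀ D.calCqᵀ) (Matrix.fromBlocks 0 1 1 0)

def lmiMiddle (X : Matrix (Fin nx ⊕ Fin nx) (Fin nx ⊕ Fin nx) ℝ)
    (Λ : Matrix (Fin nw) (Fin nw) ℝ) : Matrix
    (((Fin nx ⊕ Fin nx) ⊕ (Fin nx ⊕ Fin nx)) ⊕ ((Fin nw × Fin nθ) ⊕ (Fin nx ⊕ Fin nx)))
    (((Fin nx ⊕ Fin nx) ⊕ (Fin nx ⊕ Fin nx)) ⊕ ((Fin nw × Fin nθ) ⊕ (Fin nx ⊕ Fin nx))) ℝ :=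
  Matrix.fromBlocks
    (Matrix.fromBlocks (D.calBd * D.calBdᵀ - X) 0 0 X) 0 0
    (Matrix.fromBlocks (-(Λ ⊗ₖ D.Sθδ⁻¹)) 0 0 (D.calBp * Λ * D.calBpᵀ))

/-- The matrix inequalities of the robust controller synthesis with performance bound `γ`. -/
def RobustControllerCondition (γ : ℝ) : Prop :=
  0 < γ ∧ ∃ (X : Matrix (Fin nx ⊕ Fin nx) (Fin nx ⊕ Fin nx) ℝ) (Λ : Matrix (Fin nw) (Fin nw) ℝ),
    X.PosDef ∧ Λ.PosDef ∧ (D.calCε * X * D.calCεᵀ).trace ≤ γ ^ 2 ∧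
    (-(D.lmiOuterᵀ * D.lmiMiddle X Λ * D.lmiOuter)).PosDef

/-! ### Tube dynamics and constraint tightening -/

/-- `Σ_{J,ϑ,δ}`. -/
def SJ : Matrix ((Fin nx ⊕ Fin nu) × (Fin nx ⊕ Fin nx)) ((Fin nx ⊕ Fin nu) × (Fin nx ⊕ Fin nx)) ℝ :=
  let F := (1 : Matrix (Fin nx ⊕ Fin nu) (Fin nx ⊕ Fin nu) ℝ) ⊗ₖ (CFC.sqrt D.P * D.calBp)
  F * D.J * D.Sθδ * D.Jᵀ * Fᵀ

/-- The matrix `∑ᵢ (I ⊗ eᵢ)ᵀ Σ_{J,ϑ,δ} (I ⊗ eᵢ)`, the sum of the diagonal blocks. -/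
def SJbar : Matrix (Fin nx ⊕ Fin nu) (Fin nx ⊕ Fin nu) ℝ :=
  ∑ i : Fin nx ⊕ Fin nx, D.SJ.submatrix (fun a => (a, i)) (fun a => (a, i))

/-- Nominal state and input `(x̄, ū)` belonging to `ξ̄` and `ν`. -/
def xu (ξ : Fin nx ⊕ Fin nx → ℝ) (ν : Fin nu → ℝ) : Fin nx ⊕ Fin nu → ℝ :=
  D.diagIK *ᵥ ξ + Sum.elim (0 : Fin nx → ℝ) ν

/-- Stochastic tightening `c_{j,t}`. -/
def c (j : Fin r) (t : ℕ) : ℝ :=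
  quantile (gaussianReal 0 1) (D.p j) * wnorm (D.Sbar t) (D.diagIKᵀ *ᵥ D.h j)

/-- Nominal tightening `f_j`. -/
def f (j : Fin r) : ℝ := wnorm D.P⁻¹ (D.diagIKᵀ *ᵥ D.h j)

/-- `Q_{ξ,c} = diag(Q_c, Kᵀ R_c K)`. -/
def Qξ : Matrix (Fin nx ⊕ Fin nx) (Fin nx ⊕ Fin nx) ℝ :=
  Matrix.fromBlocks D.Qc 0 0 (D.Kᵀ * D.Rc * D.K)

/-- Terminal conditions. -/
structure TerminalAssumption : Prop where
  origin_mem : (0 : (Fin nx ⊕ Fin nx → ℝ) × ℝ) ∈ interior D.Ω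
  invariant : ∀ ξ α, (ξ, α) ∈ D.Ω →
    (D.calAhat *ᵥ ξ, D.ρ * α + wnorm D.SJbar (D.diagIK *ᵥ ξ)) ∈ D.Ω
  constraints : ∀ ξ α, (ξ, α) ∈ D.Ω → ∀ t j,
    D.h j ⬝ᵥ D.diagIK *ᵥ ξ ≤ 1 - D.c j t - α * D.f j
  decrease : ∀ ξ α, (ξ, α) ∈ D.Ω →
    quad D.S (D.calAhat *ᵥ ξ) - quad D.S ξ ≤ -quad D.Qξ ξ

/-! ### The MPC problem -/

/-- Feasibility of `m` for the MPC problem at time `t` with prescribed initial values. -/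
structure IsFeasible (t : ℕ) (init : (Fin nx ⊕ Fin nx → ℝ) × ℝ) (m : MPCVars nx nu) : Prop where
  init_ξ : m.ξ 0 = init.1
  init_α : m.α 0 = init.2
  dynamics : ∀ i < D.T, m.ξ (i + 1) = D.calAhat *ᵥ m.ξ i + D.calBνhat *ᵥ m.ν i
  tube : ∀ i < D.T, D.ρ * m.α i + wnorm D.SJbar (D.xu (m.ξ i) (m.ν i)) ≤ m.α (i + 1)
  constraints : ∀ i < D.T, ∀ j,
    D.h j ⬝ᵥ D.xu (m.ξ i) (m.ν i) ≤ 1 - D.c j (t + i) - m.α i * D.f j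
  terminal : (m.ξ D.T, m.α D.T) ∈ D.Ω

/-- The objective of the MPC problem. -/
def cost (m : MPCVars nx nu) : ℝ :=
  ∑ i ∈ Finset.range D.T, (quad D.Qξ (m.ξ i) + quad D.Rc (m.ν i)) + quad D.S (m.ξ D.T)

/-- `m` is an optimal solution of the MPC problem at time `t`. -/
def IsOptimal (t : ℕ) (init : (Fin nx ⊕ Fin nx → ℝ) × ℝ) (m : MPCVars nx nu) : Prop :=
  D.IsFeasible t init m ∧ ∀ m', D.IsFeasible t init m' → D.cost m ≤ D.cost m'

/-- Initial values of the MPC problem at time `t` when `sol s` is the solution used at time `s`: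
`(μ_{ξ,0}, 0)` at time `0`, and the one-step-ahead values of the previous solution afterwards. -/
def mpcInit (sol : ℕ → MPCVars nx nu) : ℕ → (Fin nx ⊕ Fin nx → ℝ) × ℝ
  | 0 => (D.μξ₀, 0)
  | t + 1 => ((sol t).ξ 1, (sol t).α 1)

/-! ### The closed loop -/

/-- The initial state and the noise sequences are Gaussian with the stated means and covariances;
the noise is i.i.d. in time, process and measurement noise are independent of each other, and the
initial state is independent of the noise. -/
structure IsNoise {Ω' : Type*} [MeasurableSpace Ω'] (μ : Measure Ω')
    (Qtrue : Matrix (Fin nw) (Fin nw) ℝ) (Rtrue : Matrix (Fin ny) (Fin ny) ℝ)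
    (x₀ : Ω' → Fin nx → ℝ) (w : ℕ → Ω' → Fin nw → ℝ) (v : ℕ → Ω' → Fin ny → ℝ) : Prop where
  law_x₀ : HasLaw (fun ω => WithLp.toLp 2 (x₀ ω))
    (multivariateGaussian (WithLp.toLp 2 D.μx₀) D.Sx₀) μ
  law_w : ∀ t, HasLaw (fun ω => WithLp.toLp 2 (w t ω)) (multivariateGaussian 0 Qtrue) μ
  law_v : ∀ t, HasLaw (fun ω => WithLp.toLp 2 (v t ω)) (multivariateGaussian 0 Rtrue) μ
  indep_wv : ∀ t, IndepFun (w t) (v t) μ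
  indep_time : iIndepFun (fun t ω => (w t ω, v t ω)) μ
  indep_init : IndepFun x₀ (fun ω t => (w t ω, v t ω)) μ

/-- The plant with parameter `θ` in closed loop with the controller whose additional input at time
`t` is `ν t`. -/
structure IsClosedLoop {Ω' : Type*} (θ : Fin nθ → ℝ) (ν : ℕ → Fin nu → ℝ)
    (x₀ : Ω' → Fin nx → ℝ) (w : ℕ → Ω' → Fin nw → ℝ) (v : ℕ → Ω' → Fin ny → ℝ)
    (x : ℕ → Ω' → Fin nx → ℝ) (xc : ℕ → Ω' → Fin nx → ℝ) (u : ℕ → Ω' → Fin nu → ℝ)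
    (y : ℕ → Ω' → Fin ny → ℝ) : Prop where
  x_zero : ∀ ω, x 0 ω = x₀ ω
  x_succ : ∀ t ω, x (t + 1) ω = D.A θ *ᵥ x t ω + D.B θ *ᵥ u t ω + D.E *ᵥ w t ω
  output : ∀ t ω, y t ω = D.C *ᵥ x t ω + v t ω
  xc_zero : ∀ ω, xc 0 ω = 0
  xc_succ : ∀ t ω, xc (t + 1) ω = D.Ac *ᵥ xc t ω + D.L *ᵥ y t ω
  input : ∀ t ω, u t ω = D.K *ᵥ xc t ω + ν t

end Design

end D2PC

end

/-! The MPC problem is initialised from its own prediction, so the added inputs are deterministic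
and the closed loop is an affine system driven by Gaussian noise. It splits into a deterministic
mean and a centred Gaussian error (`IsClosedLoop.eq_add`) that do not interact.

Feasibility is the shift argument: the tail of a solution, extended by zero additional input, stays
feasible because the terminal set is invariant (`IsFeasible.shift`). For the chance constraints, the
tube bounds the distance from the mean to the nominal prediction in the `P`-norm
(`wnorm_meanTraj_sub_le`), and norm duality turns this into the tightening `f`. The error variance
is at most that of `Sbar` (`errVar_le`), and the Gaussian quantile turns this into `c`.

For the cost, the optimal value drops by at least the input cost in each step, so the inputs tend to
zero (`tendsto_wnorm_ν`) and the contraction drives the mean to zero. Only the error variance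
survives. The matrix inequality makes `X` a Lyapunov bound for every admissible parameter
(`robust_lyapunov`), so the variance of each performance output converges to a limit below its value
under `X` (`exists_tendsto_errVar`). The trace condition bounds the sum of these limits by `γ ^ 2`,
and Cesàro averaging keeps the limit. -/

namespace D2PC

/-! ### Quadratic forms, weighted norms and contractions -/

section QuadraticForms

variable {ι κ : Type*} [Fintype ι] [Fintype κ]

theorem quad_nonneg {M : Matrix ι ι ℝ} (hM : M.PosSemidef) (v : ι → ℝ) : 0 ≤ quad M v := by
  simpa [quad] using hM.dotProduct_mulVec_nonneg v

theorem quad_add_left (M N : Matrix ι ι ℝ) (v : ι → ℝ) : quad (M + N) v = quad M v + quad N v := by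
  simp [quad, Matrix.add_mulVec]

theorem quad_sub_left (M N : Matrix ι ι ℝ) (v : ι → ℝ) : quad (M - N) v = quad M v - quad N v := by
  simp [quad, Matrix.sub_mulVec]

theorem quad_neg_left (M : Matrix ι ι ℝ) (v : ι → ℝ) : quad (-M) v = -quad M v := by
  simp [quad, Matrix.neg_mulVec]

theorem quad_smul_left (c : ℝ) (M : Matrix ι ι ℝ) (v : ι → ℝ) : quad (c • M) v = c * quad M v := by
  simp [quad, Matrix.smul_mulVec]

theorem quad_zero_left (v : ι → ℝ) : quad (0 : Matrix ι ι ℝ) v = 0 := by simp [quad]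

theorem quad_zero_right (M : Matrix ι ι ℝ) : quad M 0 = 0 := by simp [quad]

theorem quad_conj (G : Matrix ι κ ℝ) (M : Matrix κ κ ℝ) (v : ι → ℝ) :
    quad (G * M * Gᵀ) v = quad M (Gᵀ *ᵥ v) := by
  simp only [quad]
  rw [← Matrix.mulVec_mulVec, ← Matrix.mulVec_mulVec, Matrix.dotProduct_mulVec,
    Matrix.mulVec_transpose]

theorem quad_transpose_conj (G : Matrix κ ι ℝ) (M : Matrix κ κ ℝ) (v : ι → ℝ) :
    quad (Gᵀ * M * G) v = quad M (G *ᵥ v) := by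
  simpa using quad_conj Gᵀ M v

theorem quad_gram (G : Matrix κ ι ℝ) (v : ι → ℝ) : quad (Gᵀ * G) v = ∑ i, (G *ᵥ v) i ^ 2 := by
  classical
  have := quad_transpose_conj G (1 : Matrix κ κ ℝ) v
  rw [Matrix.mul_one] at this
  rw [this]
  simp [quad, dotProduct, sq]

theorem quad_fromBlocks_diag (M : Matrix ι ι ℝ) (N : Matrix κ κ ℝ) (v : ι → ℝ) (w : κ → ℝ) :
    quad (Matrix.fromBlocks M 0 0 N) (Sum.elim v w) = quad M v + quad N w := by
  simp [quad, Matrix.fromBlocks_mulVec, Sum.elim_comp_inl, Sum.elim_comp_inr]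

/-- Splits the trace condition into one variance bound per coordinate of the performance output. -/
theorem trace_conj_eq_sum_quad (G : Matrix κ ι ℝ) (M : Matrix ι ι ℝ) :
    (G * M * Gᵀ).trace = ∑ i, quad M (G i) := by
  simp only [Matrix.trace, Matrix.diag, quad]
  refine Finset.sum_congr rfl fun i _ => ?_
  rw [Matrix.mul_assoc, Matrix.mul_apply_eq_vecMul]
  simp [Matrix.vecMul, Matrix.mul_apply, dotProduct, Matrix.mulVec]

theorem continuous_quad (M : Matrix ι ι ℝ) : Continuous (quad M) := by
  unfold quad
  fun_prop

theorem wnorm_nonneg (M : Matrix ι ι ℝ) (v : ι → ℝ) : 0 ≤ wnorm M v := Real.sqrt_nonneg _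

theorem sq_wnorm {M : Matrix ι ι ℝ} (hM : M.PosSemidef) (v : ι → ℝ) :
    wnorm M v ^ 2 = quad M v := Real.sq_sqrt (quad_nonneg hM v)

theorem wnorm_zero (M : Matrix ι ι ℝ) : wnorm M 0 = 0 := by simp [wnorm, quad_zero_right]

theorem wnorm_add_le {M : Matrix ι ι ℝ} (hM : M.PosSemidef) (v w : ι → ℝ) :
    wnorm M (v + w) ≤ wnorm M v + wnorm M w := by
  classical
  simp only [wnorm_eq_norm_sqrt hM, Matrix.mulVec_add, WithLp.toLp_add]
  exact norm_add_le _ _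

/-- Cauchy–Schwarz after factoring `M` through its square root; definiteness is not needed. -/
theorem dotProduct_mulVec_le {M : Matrix ι ι ℝ} (hM : M.PosSemidef) (v w : ι → ℝ) :
    v ⬝ᵥ M *ᵥ w ≤ wnorm M v * wnorm M w := by
  classical
  have hs : (CFC.sqrt M).IsHermitian :=
    (Matrix.nonneg_iff_posSemidef.mp (CFC.sqrt_nonneg M)).isHermitian
  have hT : (CFC.sqrt M)ᵀ = CFC.sqrt M := by simpa using hs.eq
  have h : v ⬝ᵥ M *ᵥ w = inner ℝ (WithLp.toLp 2 (CFC.sqrt M *ᵥ v)) (WithLp.toLp 2 (CFC.sqrt M *ᵥ w)) := by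
    conv_lhs => rw [← CFC.sqrt_mul_sqrt_self M hM.nonneg]
    rw [← Matrix.mulVec_mulVec, Matrix.dotProduct_mulVec, ← Matrix.mulVec_transpose, hT,
      EuclideanSpace.inner_toLp_toLp, star_trivial, dotProduct_comm]
  rw [h, wnorm_eq_norm_sqrt hM, wnorm_eq_norm_sqrt hM]
  exact real_inner_le_norm _ _

theorem wnorm_mulVec_le_of_contraction {M A : Matrix ι ι ℝ} {ρ : ℝ} (hρ : 0 ≤ ρ)
    (h : (ρ ^ 2 • M - Aᵀ * M * A).PosSemidef) (v : ι → ℝ) :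
    wnorm M (A *ᵥ v) ≤ ρ * wnorm M v := by
  have := quad_nonneg h v
  rw [quad_sub_left, quad_smul_left, quad_transpose_conj] at this
  calc wnorm M (A *ᵥ v) ≤ √(ρ ^ 2 * quad M v) := Real.sqrt_le_sqrt (by linarith)
    _ = ρ * wnorm M v := by rw [Real.sqrt_mul (sq_nonneg ρ), Real.sqrt_sq hρ, wnorm]

variable [DecidableEq ι]

/-- Duality of the norms weighted by `M` and `M⁻¹`. -/
theorem dotProduct_le_wnorm_inv_mul_wnorm {M : Matrix ι ι ℝ} (hM : M.PosDef) (a v : ι → ℝ) :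
    a ⬝ᵥ v ≤ wnorm M⁻¹ a * wnorm M v := by
  have hu : IsUnit M.det := hM.det_pos.ne'.isUnit
  have hT : M⁻¹ᵀ = M⁻¹ := by simpa using hM.isHermitian.inv.eq
  have h1 : (M⁻¹ *ᵥ a) ⬝ᵥ M *ᵥ v = a ⬝ᵥ v := by
    rw [← hT, Matrix.mulVec_transpose, ← Matrix.dotProduct_mulVec, Matrix.mulVec_mulVec,
      Matrix.nonsing_inv_mul _ hu, Matrix.one_mulVec]
  have h2 : wnorm M (M⁻¹ *ᵥ a) = wnorm M⁻¹ a := by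
    rw [wnorm, ← quad_transpose_conj, hT, Matrix.nonsing_inv_mul _ hu, Matrix.one_mul, wnorm]
  rw [← h1, ← h2]
  exact dotProduct_mulVec_le hM.posSemidef _ _

theorem abs_dotProduct_le_wnorm_inv_mul_wnorm {M : Matrix ι ι ℝ} (hM : M.PosDef) (a v : ι → ℝ) :
    |a ⬝ᵥ v| ≤ wnorm M⁻¹ a * wnorm M v := by
  refine abs_le'.mpr ⟨dotProduct_le_wnorm_inv_mul_wnorm hM a v, ?_⟩
  have h := dotProduct_le_wnorm_inv_mul_wnorm hM a (-v)
  have hn : wnorm M (-v) = wnorm M v := by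
    simp only [wnorm, quad, Matrix.mulVec_neg, neg_dotProduct_neg]
  rwa [dotProduct_neg, hn] at h

theorem sq_dotProduct_le_quad_inv_mul_quad {M : Matrix ι ι ℝ} (hM : M.PosDef) (a v : ι → ℝ) :
    (a ⬝ᵥ v) ^ 2 ≤ quad M⁻¹ a * quad M v := by
  rw [← sq_wnorm hM.posSemidef, ← sq_wnorm hM.inv.posSemidef, ← mul_pow]
  exact sq_le_sq' (abs_le.mp (abs_dotProduct_le_wnorm_inv_mul_wnorm hM a v)).1
    (dotProduct_le_wnorm_inv_mul_wnorm hM a v)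

theorem tendsto_dotProduct_of_tendsto_wnorm {M : Matrix ι ι ℝ} (hM : M.PosDef)
    {v : ℕ → ι → ℝ} (h : Tendsto (fun t => wnorm M (v t)) atTop (𝓝 0)) (a : ι → ℝ) :
    Tendsto (fun t => a ⬝ᵥ v t) atTop (𝓝 0) :=
  squeeze_zero_norm (fun t => abs_dotProduct_le_wnorm_inv_mul_wnorm hM a (v t))
    (by simpa using h.const_mul (wnorm M⁻¹ a))

end QuadraticForms

/-- A scalar contraction driven by a vanishing sequence vanishes. -/
theorem tendsto_zero_of_contraction {a b : ℕ → ℝ} {ρ : ℝ} (hρ : 0 ≤ ρ) (hρ1 : ρ < 1)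
    (ha : ∀ t, 0 ≤ a t) (hab : ∀ t, a (t + 1) ≤ ρ * a t + b t)
    (hb : Tendsto b atTop (𝓝 0)) : Tendsto a atTop (𝓝 0) := by
  refine tendsto_order.mpr ⟨fun c hc => .of_forall fun t => hc.trans_le (ha t), fun ε hε => ?_⟩
  -- With this bound on the driving term, `ε / 2` is the fixed point of `s ↦ ρ * s + (1 - ρ) * (ε /
  -- 2)`.
  have hε' : 0 < (1 - ρ) * (ε / 2) := by nlinarith
  obtain ⟨N, hN⟩ := eventually_atTop.mp (hb.eventually_le_const hε')
  have key : ∀ k, a (N + k) ≤ ρ ^ k * a N + ε / 2 := by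
    intro k
    induction k with
    | zero => simp; linarith
    | succ k ih =>
      have h1 := hab (N + k)
      have h2 := hN (N + k) (by omega)
      have h3 := mul_le_mul_of_nonneg_left ih hρ
      rw [← add_assoc, pow_succ]
      nlinarith
  have hlim : Tendsto (fun k => ρ ^ k * a N + ε / 2) atTop (𝓝 (0 * a N + ε / 2)) :=
    ((tendsto_pow_atTop_nhds_zero_of_lt_one hρ hρ1).mul_const _).add_const _
  obtain ⟨k₀, hk₀⟩ := eventually_atTop.mp
    (hlim.eventually_lt_const (show 0 * a N + ε / 2 < ε by linarith))
  filter_upwards [eventually_ge_atTop (N + k₀)] with t ht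
  obtain ⟨k, rfl⟩ := Nat.exists_eq_add_of_le (show N ≤ t by omega)
  exact (key k).trans_lt (hk₀ k (by omega))

end D2PC

namespace D2PC

/-! ### Quantiles of the normal and chi-squared distributions -/

section Quantiles

variable {μ : Measure ℝ} {p : ℝ}

/-- Right continuity of the cdf makes the infimum attained; `0 < p < 1` makes the set bounded below
and nonempty. -/
theorem le_cdf_quantile (hp0 : 0 < p) (hp1 : p < 1) :
    p ≤ cdf μ (quantile μ p) := by
  set s : Set ℝ := {x : ℝ | p ≤ cdf μ x} with hs
  have hne : s.Nonempty :=
    ((tendsto_cdf_atTop μ).eventually_const_le hp1).exists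
  have hbdd : BddBelow s := by
    obtain ⟨a, ha⟩ := eventually_atBot.mp ((tendsto_cdf_atBot μ).eventually_lt_const hp0)
    refine ⟨a, fun x hx => ?_⟩
    by_contra! hxa
    exact absurd (ha x hxa.le) (not_lt.mpr hx)
  have hright : Tendsto (cdf μ) (𝓝[>] (quantile μ p)) (𝓝 (cdf μ (quantile μ p))) :=
    ((cdf μ).right_continuous _).mono_left (nhdsWithin_mono _ Set.Ioi_subset_Ici_self)
  refine ge_of_tendsto hright ?_
  filter_upwards [self_mem_nhdsWithin] with x hx
  obtain ⟨y, hy, hyx⟩ := (csInf_lt_iff hbdd hne).mp (show sInf s < x from hx)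
  exact le_trans hy (monotone_cdf μ hyx.le)

theorem lt_quantile {a : ℝ} (ha : cdf μ a < p) (hp1 : p < 1) : a < quantile μ p := by
  by_contra! h
  exact absurd ((le_cdf_quantile ((cdf_nonneg μ a).trans_lt ha) hp1).trans (monotone_cdf μ h))
    (not_le.mpr ha)

/-- By symmetry the two tails beyond `x` and `-x` have equal mass, and the open interval between
them has positive mass. -/
theorem cdf_gaussianReal_lt_half {x : ℝ} (hx : x < 0) : cdf (gaussianReal 0 1) x < 1 / 2 := by
  have hopen : (gaussianReal 0 1).IsOpenPosMeasure :=
    (gaussianReal_absolutelyContinuous' 0 one_ne_zero).isOpenPosMeasure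
  have hsymm : (gaussianReal 0 1).real (Set.Iic x) = (gaussianReal 0 1).real (Set.Ici (-x)) := by
    have h := gaussianReal_map_neg (μ := 0) (v := 1)
    rw [neg_zero] at h
    conv_lhs => rw [← h]
    rw [map_measureReal_apply (by fun_prop) measurableSet_Iic]
    congr 1
    ext y
    simp
  have hpos : 0 < (gaussianReal 0 1).real (Set.Ioo x (-x)) := by
    rw [measureReal_def, ENNReal.toReal_pos_iff]
    exact ⟨isOpen_Ioo.measure_pos _ (Set.nonempty_Ioo.mpr (by linarith)), measure_lt_top _ _⟩
  have hd1 : Disjoint (Set.Iic x) (Set.Ioo x (-x)) :=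
    Set.disjoint_left.mpr fun y (h1 : y ≤ x) h2 => absurd h2.1 (not_lt.mpr h1)
  have hd2 : Disjoint (Set.Iic x ∪ Set.Ioo x (-x)) (Set.Ici (-x)) := by
    refine Set.disjoint_left.mpr fun y h1 (h2 : -x ≤ y) => ?_
    rcases h1 with h1 | h1
    · have : y ≤ x := h1
      linarith
    · exact absurd h1.2 (not_lt.mpr h2)
  have hle : (gaussianReal 0 1).real (Set.Iic x ∪ Set.Ioo x (-x) ∪ Set.Ici (-x)) ≤ 1 :=
    measureReal_le_one
  rw [measureReal_union hd2 measurableSet_Ici, measureReal_union hd1 measurableSet_Ioo] at hle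
  rw [cdf_eq_real]
  linarith

theorem quantile_gaussianReal_nonneg (hp : 1 / 2 ≤ p) (hp1 : p < 1) :
    0 ≤ quantile (gaussianReal 0 1) p := by
  by_contra! h
  have h1 := le_cdf_quantile (μ := gaussianReal 0 1) (by linarith) hp1
  linarith [cdf_gaussianReal_lt_half h]

instance isProbabilityMeasure_chiSquared (n : ℕ) : IsProbabilityMeasure (chiSquared n) :=
  Measure.isProbabilityMeasure_map (Measurable.aemeasurable (by fun_prop))

/-- A sum of squares is nonpositive only at the origin, a null set in positive dimension. In
dimension zero the law is the point mass at `0`, hence `n ≠ 0`. -/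
theorem quantile_chiSquared_pos {n : ℕ} (hn : n ≠ 0) (hp0 : 0 < p) (hp1 : p < 1) :
    0 < quantile (chiSquared n) p := by
  refine lt_quantile ?_ hp1
  have h0 : (chiSquared n).real (Set.Iic 0) = 0 := by
    rw [chiSquared, map_measureReal_apply (by fun_prop) measurableSet_Iic, measureReal_def,
      ENNReal.toReal_eq_zero_iff]
    left
    have := nullSingletonClass_gaussianReal (μ := 0) one_ne_zero
    have hsub : (fun x : Fin n → ℝ => ∑ i, x i ^ 2) ⁻¹' Set.Iic 0 ⊆ {0} := by
      intro x (hx : ∑ i, x i ^ 2 ≤ 0)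
      have h1 := (Finset.sum_eq_zero_iff_of_nonneg fun i _ => sq_nonneg (x i)).mp
        (le_antisymm hx (Finset.sum_nonneg fun i _ => sq_nonneg (x i)))
      ext i
      simpa using h1 i (Finset.mem_univ i)
    refine measure_mono_null hsub ?_
    rw [← Set.univ_pi_singleton, Measure.pi_pi]
    exact Finset.prod_eq_zero (Finset.mem_univ (⟨0, Nat.pos_of_ne_zero hn⟩ : Fin n)) (measure_singleton _)
  rw [cdf_eq_real, h0]
  exact hp0

end Quantiles

/-! ### Laws and moments of Gaussian variables -/

section GaussianVectors

variable {Ω' : Type*} [MeasurableSpace Ω'] {μ : Measure Ω'}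

/-- The law of `X` is the image of the standard normal under multiplication by `√v`; scaling up
instead of normalising covers `v = 0`. -/
theorem le_measureReal_gaussian_le {X : Ω' → ℝ} {v p b : ℝ} (hv : 0 ≤ v)
    (hX : HasLaw X (gaussianReal 0 v.toNNReal) μ) (hp0 : 0 < p) (hp1 : p < 1)
    (hb : quantile (gaussianReal 0 1) p * √v ≤ b) : p ≤ μ.real {ω | X ω ≤ b} := by
  rw [hX.measureReal_eq measurableSet_Iic]
  have hmap : gaussianReal 0 v.toNNReal = (gaussianReal 0 1).map (√v * ·) := by
    rw [gaussianReal_map_const_mul]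
    congr 1
    · simp
    · ext
      simp [Real.sq_sqrt hv, hv]
  change p ≤ (gaussianReal 0 v.toNNReal).real (Set.Iic b)
  rw [hmap, map_measureReal_apply (by fun_prop) measurableSet_Iic]
  refine (le_cdf_quantile (μ := gaussianReal 0 1) hp0 hp1).trans ?_
  rw [cdf_eq_real]
  refine measureReal_mono fun y (hy : y ≤ _) => ?_
  have := mul_le_mul_of_nonneg_right hy (Real.sqrt_nonneg v)
  simp only [Set.mem_preimage, Set.mem_Iic]
  linarith

theorem hasLaw_dotProduct_of_multivariateGaussian {ι : Type*} [Fintype ι] [DecidableEq ι]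
    {X : Ω' → ι → ℝ} {m : ι → ℝ} {S : Matrix ι ι ℝ} (hS : S.PosSemidef)
    (hX : HasLaw (fun ω => WithLp.toLp 2 (X ω)) (multivariateGaussian (WithLp.toLp 2 m) S) μ)
    (g : ι → ℝ) :
    HasLaw (fun ω => g ⬝ᵥ X ω) (gaussianReal (g ⬝ᵥ m) (quad S g).toNNReal) μ := by
  let L : StrongDual ℝ (EuclideanSpace ℝ ι) := innerSL ℝ (WithLp.toLp 2 g)
  have hL : ∀ x, L x = g ⬝ᵥ x.ofLp := fun x => by
    simp [L, EuclideanSpace.inner_eq_star_dotProduct, dotProduct_comm]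
  have hmap : HasLaw L (gaussianReal (g ⬝ᵥ m) (quad S g).toNNReal)
      (multivariateGaussian (WithLp.toLp 2 m) S) := by
    refine ⟨by fun_prop, ?_⟩
    rw [IsGaussian.map_eq_gaussianReal]
    congr 2
    · rw [ContinuousLinearMap.integral_comp_id_comm, integral_id_multivariateGaussian, hL]
      exact IsGaussian.integrable_id
    · have := covarianceBilin_multivariateGaussian (μ := WithLp.toLp 2 m) hS
        (WithLp.toLp 2 g) (WithLp.toLp 2 g)
      rw [covarianceBilin_self IsGaussian.memLp_two_id] at this
      exact this
  have := hmap.comp hX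
  refine this.congr (.of_forall fun ω => ?_)
  simp [hL]

theorem hasLaw_add_gaussian {X Y : Ω' → ℝ} {a b : ℝ} (ha : 0 ≤ a) (hb : 0 ≤ b)
    (hXY : IndepFun X Y μ) (hX : HasLaw X (gaussianReal 0 a.toNNReal) μ)
    (hY : HasLaw Y (gaussianReal 0 b.toNNReal) μ) :
    HasLaw (X + Y) (gaussianReal 0 (a + b).toNNReal) μ :=
  ⟨hX.aemeasurable.add hY.aemeasurable, by
    rw [gaussianReal_add_gaussianReal_of_indepFun hXY hX.map_eq hY.map_eq, add_zero,
      Real.toNNReal_add ha hb]⟩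

theorem hasLaw_sum_gaussian {X : ℕ → Ω' → ℝ} {a : ℕ → ℝ} (ha : ∀ i, 0 ≤ a i)
    [IsProbabilityMeasure μ]
    (hX : iIndepFun X μ) (hlaw : ∀ i, HasLaw (X i) (gaussianReal 0 (a i).toNNReal) μ) (n : ℕ) :
    HasLaw (∑ i ∈ Finset.range n, X i)
      (gaussianReal 0 (∑ i ∈ Finset.range n, a i).toNNReal) μ := by
  induction n with
  | zero =>
    simp only [Finset.range_zero, Finset.sum_empty, Real.toNNReal_zero, gaussianReal_zero_var]
    exact hasLaw_dirac_of_ae_eq (.of_forall fun _ => rfl)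
  | succ n ih =>
    rw [Finset.sum_range_succ, Finset.sum_range_succ]
    exact hasLaw_add_gaussian (Finset.sum_nonneg fun i _ => ha i) (ha n)
      (hX.indepFun_finsetSum_of_notMem₀ (fun i => (hlaw i).aemeasurable) Finset.notMem_range_self)
      ih (hlaw n)

/-- Second moment of a shifted centred Gaussian variable. -/
theorem integrable_sq_add_and_integral {X : Ω' → ℝ} {v : ℝ} (hv : 0 ≤ v) [IsProbabilityMeasure μ]
    (hX : HasLaw X (gaussianReal 0 v.toNNReal) μ) (s : ℝ) :
    Integrable (fun ω => (s + X ω) ^ 2) μ ∧ ∫ ω, (s + X ω) ^ 2 ∂μ = s ^ 2 + v := by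
  have hL : MemLp (fun ω => s + X ω) 2 μ := by
    refine (memLp_const s).add ?_
    have h := memLp_id_gaussianReal (μ := 0) (v := v.toNNReal) 2
    rw [← hX.map_eq] at h
    exact (memLp_map_measure_iff (by fun_prop) hX.aemeasurable).mp h
  refine ⟨hL.integrable_sq, ?_⟩
  have hlaw := gaussianReal_const_add hX s
  have hvar := hlaw.variance_eq
  have hmean := hlaw.integral_eq
  rw [variance_eq_sub hL] at hvar
  simp only [integral_id_gaussianReal, variance_id_gaussianReal, zero_add,
    Real.coe_toNNReal _ hv] at hvar hmean
  simp only [Pi.pow_apply] at hvar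
  rw [hmean] at hvar
  linarith

end GaussianVectors

end D2PC

/-! ### Shifted candidate, recursive feasibility and decay of the optimal cost -/

namespace D2PC

namespace Design

variable {nx nu ny nw nθ nε r : ℕ} (D : Design nx nu ny nw nθ nε r)

theorem xu_zero_right (ξ : Fin nx ⊕ Fin nx → ℝ) : D.xu ξ 0 = D.diagIK *ᵥ ξ := by
  simp [xu]

/-- The candidate solution obtained by shifting `m` by one time step and appending the terminal
controller. -/
noncomputable def shift (m : MPCVars nx nu) : MPCVars nx nu where
  -- There are `T` inputs but `T + 1` states, so the appended input has index `T - 1` and the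
  -- appended state and tube size have index `T`.
  ν i := if i + 1 < D.T then m.ν (i + 1) else 0
  ξ i := if i < D.T then m.ξ (i + 1) else D.calAhat *ᵥ m.ξ D.T
  α i := if i < D.T then m.α (i + 1)
    else D.ρ * m.α D.T + wnorm D.SJbar (D.diagIK *ᵥ m.ξ D.T)

variable {D}

theorem IsFeasible.shift (hD : D.Standing) (h3 : D.TerminalAssumption) {t : ℕ}
    {init : (Fin nx ⊕ Fin nx → ℝ) × ℝ} {m : MPCVars nx nu} (hm : D.IsFeasible t init m) :
    D.IsFeasible (t + 1) (m.ξ 1, m.α 1) (D.shift m) := by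
  have hT := hD.T_pos
  have hT' : 0 < D.T := hT
  refine ⟨by simp [Design.shift, hT'], by simp [Design.shift, hT'], fun i hi => ?_, fun i hi => ?_,
    fun i hi j => ?_, ?_⟩
  · rcases Nat.lt_or_ge (i + 1) D.T with h | h
    · simpa [Design.shift, h, hi] using hm.dynamics (i + 1) h
    · have h' : i + 1 = D.T := by omega
      simp [Design.shift, hi, h']
  · rcases Nat.lt_or_ge (i + 1) D.T with h | h
    · simpa [Design.shift, h, hi] using hm.tube (i + 1) h
    · have h' : i + 1 = D.T := by omega
      simp [Design.shift, hi, h', xu_zero_right]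
  · rcases Nat.lt_or_ge (i + 1) D.T with h | h
    · simpa [Design.shift, h, hi, add_assoc, add_comm 1 i] using hm.constraints (i + 1) h j
    · have h' : i + 1 = D.T := by omega
      -- The terminal condition covers all times, so it applies at the shifted time `t + 1 + i`.
      simpa [Design.shift, hi, h', xu_zero_right] using
        h3.constraints _ _ hm.terminal (t + 1 + i) j
  · simpa [Design.shift] using h3.invariant _ _ hm.terminal

theorem quad_Qξ (ξ : Fin nx ⊕ Fin nx → ℝ) :
    quad D.Qξ ξ = quad D.Qc (ξ ∘ Sum.inl) + quad D.Rc (D.K *ᵥ (ξ ∘ Sum.inr)) := by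
  conv_lhs => rw [← Sum.elim_comp_inl_inr ξ, Qξ, quad_fromBlocks_diag, quad_transpose_conj]

theorem quad_Qξ_nonneg (hD : D.Standing) (ξ : Fin nx ⊕ Fin nx → ℝ) : 0 ≤ quad D.Qξ ξ := by
  rw [quad_Qξ, ← hD.Qc_eq, quad_gram]
  exact add_nonneg (Finset.sum_nonneg fun i _ => sq_nonneg _)
    (quad_nonneg hD.Rc_posDef.posSemidef _)

theorem cost_nonneg (hD : D.Standing) (m : MPCVars nx nu) : 0 ≤ D.cost m :=
  add_nonneg (Finset.sum_nonneg fun _ _ =>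
    add_nonneg (quad_Qξ_nonneg hD _) (quad_nonneg hD.Rc_posDef.posSemidef _))
    (quad_nonneg hD.S_posSemidef _)

/-- The terminal decrease pays for the appended stage, so the net saving is the removed first stage.
Only its input part is kept, as that alone is needed for the inputs to vanish. -/
theorem cost_shift_le (hD : D.Standing) (h3 : D.TerminalAssumption) {t : ℕ}
    {init : (Fin nx ⊕ Fin nx → ℝ) × ℝ} {m : MPCVars nx nu} (hm : D.IsFeasible t init m) :
    D.cost (D.shift m) ≤ D.cost m - quad D.Rc (m.ν 0) := by
  obtain ⟨n, hn⟩ : ∃ n, D.T = n + 1 := Nat.exists_eq_succ_of_ne_zero (by have := hD.T_pos; omega)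
  have hdec := h3.decrease _ _ hm.terminal
  have hsum : ∑ i ∈ Finset.range n, (quad D.Qξ ((D.shift m).ξ i) + quad D.Rc ((D.shift m).ν i))
      = ∑ i ∈ Finset.range n, (quad D.Qξ (m.ξ (i + 1)) + quad D.Rc (m.ν (i + 1))) := by
    refine Finset.sum_congr rfl fun i hi => ?_
    have hi' := Finset.mem_range.mp hi
    have h1 : i < D.T := by omega
    have h2 : i + 1 < D.T := by omega
    simp [Design.shift, h1, h2]
  have hlast : (D.shift m).ξ n = m.ξ D.T := by simp [Design.shift, hn]
  have hν : (D.shift m).ν n = 0 := by simp [Design.shift, hn]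
  have hterm : (D.shift m).ξ (n + 1) = D.calAhat *ᵥ m.ξ D.T := by simp [Design.shift, hn]
  have h0 := quad_Qξ_nonneg hD (m.ξ 0)
  rw [cost, cost, hn, Finset.sum_range_succ, Finset.sum_range_succ', hsum, hlast, hν, hterm,
    quad_zero_right, ← hn]
  linarith

theorem isFeasible_shift_sol (hD : D.Standing) (h3 : D.TerminalAssumption) {t : ℕ}
    {sol : ℕ → MPCVars nx nu} (h : D.IsFeasible t (D.mpcInit sol t) (sol t)) :
    D.IsFeasible (t + 1) (D.mpcInit sol (t + 1)) (D.shift (sol t)) := h.shift hD h3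

/-- Along the closed loop, the inputs added to the robust controller vanish. -/
theorem tendsto_wnorm_ν (hD : D.Standing) (h3 : D.TerminalAssumption)
    {sol : ℕ → MPCVars nx nu} (h : ∀ t, D.IsOptimal t (D.mpcInit sol t) (sol t)) :
    Tendsto (fun t => wnorm D.Rc ((sol t).ν 0)) atTop (𝓝 0) := by
  have hdec : ∀ t, D.cost (sol (t + 1)) + quad D.Rc ((sol t).ν 0) ≤ D.cost (sol t) := fun t => by
    have h1 := (h (t + 1)).2 _ (isFeasible_shift_sol hD h3 (h t).1)
    linarith [cost_shift_le hD h3 (h t).1]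
  have hbound : ∀ N, ∑ t ∈ Finset.range N, quad D.Rc ((sol t).ν 0) + D.cost (sol N)
      ≤ D.cost (sol 0) := by
    intro N
    induction N with
    | zero => simp
    | succ N ih =>
      rw [Finset.sum_range_succ]
      linarith [hdec N]
  have hsum : Summable fun t => quad D.Rc ((sol t).ν 0) :=
    summable_of_sum_range_le (fun t => quad_nonneg hD.Rc_posDef.posSemidef _)
      (fun N => (le_add_of_nonneg_right (cost_nonneg hD _)).trans (hbound N))
  simpa [wnorm] using hsum.tendsto_atTop_zero.sqrt

end Design

end D2PC

namespace D2PC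

namespace Design

variable {nx nu ny nw nθ nε r : ℕ} {D : Design nx nu ny nw nθ nε r}

/-! ### The uncertainty set -/

theorem Sθδ_posDef (hD : D.Standing) : D.Sθδ.PosDef := by
  rcases eq_or_ne nθ 0 with rfl | hn
  -- Without parameters the chi-squared factor need not be positive, but all matrices over an empty
  -- index type agree.
  · have : D.Sθδ = D.Sθ := Matrix.ext fun i => i.elim0
    rw [this]
    exact hD.Sθ_posDef
  · exact hD.Sθ_posDef.smul (quantile_chiSquared_pos hn hD.δ_mem.1 hD.δ_mem.2)

variable {θ : Fin nθ → ℝ}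

theorem transpose_Δ_mulVec (b : Fin nw → ℝ) :
    (D.Δ θ)ᵀ *ᵥ b = fun k => b k.1 * (θ - D.θhat) k.2 := by
  ext k
  simp [Matrix.mulVec, dotProduct, Δ, Matrix.one_apply, mul_comm]

/-- `Δᵀ b` is a pure tensor, so the multiplier `Λ ⊗ₖ Sθδ⁻¹` splits into a form in `b` times the
ellipsoid form of `θ - θhat`. -/
theorem quad_kronecker {ι κ : Type*} [Fintype ι] [Fintype κ] (M : Matrix ι ι ℝ) (N : Matrix κ κ ℝ)
    (a : ι → ℝ) (b : κ → ℝ) :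
    quad (M ⊗ₖ N) (fun k => a k.1 * b k.2) = quad M a * quad N b := by
  have h : (M ⊗ₖ N) *ᵥ (fun k => a k.1 * b k.2) = fun k => (M *ᵥ a) k.1 * (N *ᵥ b) k.2 := by
    ext k
    simp only [Matrix.mulVec, dotProduct, Matrix.kroneckerMap_apply, Fintype.sum_prod_type,
      Finset.sum_mul_sum]
    exact Finset.sum_congr rfl fun _ _ => Finset.sum_congr rfl fun _ _ => by ring
  rw [quad, h]
  simp only [quad, dotProduct, Fintype.sum_prod_type, Finset.sum_mul_sum]
  exact Finset.sum_congr rfl fun _ _ => Finset.sum_congr rfl fun _ _ => by ring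

theorem Δ_mul_JΔ_apply (l : Fin nw) (j : Fin nx ⊕ Fin nu) :
    (D.Δ θ * D.JΔ) l j = ∑ k, D.J (j, l) k * (θ - D.θhat) k := by
  simp [Matrix.mul_apply, Δ, JΔ, Fintype.sum_prod_type, Matrix.one_apply, mul_comm]

/-- Each coordinate of the disturbance, after scaling by `P^{1/2}`, is linear in `θ - θhat`.
Cauchy–Schwarz over the ellipsoid bounds its square by a quadratic form in `z`, and `SJbar` sums
these forms. -/
theorem wnorm_calBp_mulVec_le (hD : D.Standing) (hP : D.P.PosDef) (hθ : θ ∈ D.Θδ)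
    (z : Fin nx ⊕ Fin nu → ℝ) :
    wnorm D.P ((D.calBp * D.Δ θ * D.JΔ) *ᵥ z) ≤ wnorm D.SJbar z := by
  refine Real.sqrt_le_sqrt ?_
  set F := CFC.sqrt D.P * D.calBp with hF
  set G := ((1 : Matrix (Fin nx ⊕ Fin nu) (Fin nx ⊕ Fin nu) ℝ) ⊗ₖ F) * D.J with hG
  let a : Fin nx ⊕ Fin nx → Fin nθ → ℝ := fun i => (G.submatrix (fun a => (a, i)) id)ᵀ *ᵥ z
  have hs : (CFC.sqrt D.P).IsHermitian :=
    (Matrix.nonneg_iff_posSemidef.mp (CFC.sqrt_nonneg D.P)).isHermitian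
  have hT : (CFC.sqrt D.P)ᵀ = CFC.sqrt D.P := by simpa using hs.eq
  have hcoord : ∀ i, (F *ᵥ ((D.Δ θ * D.JΔ) *ᵥ z)) i = a i ⬝ᵥ (θ - D.θhat) := by
    intro i
    have hGi : ∀ j k, G (j, i) k = ∑ l, F i l * D.J (j, l) k := fun j k => by
      simp [hG, Matrix.mul_apply, Fintype.sum_prod_type, Matrix.one_apply]
    simp only [a, Matrix.mulVec, dotProduct, Matrix.transpose_apply, Matrix.submatrix_apply, id,
      hGi, Δ_mul_JΔ_apply, Finset.mul_sum, Finset.sum_mul]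
    rw [Finset.sum_comm]
    simp_rw [Finset.sum_comm (s := (Finset.univ : Finset (Fin nw)))]
    rw [Finset.sum_comm]
    exact Finset.sum_congr rfl fun _ _ => Finset.sum_congr rfl fun _ _ =>
      Finset.sum_congr rfl fun _ _ => by ring
  have hl : quad D.P ((D.calBp * D.Δ θ * D.JΔ) *ᵥ z) = ∑ i, (a i ⬝ᵥ (θ - D.θhat)) ^ 2 := by
    conv_lhs => rw [← CFC.sqrt_mul_sqrt_self D.P hP.posSemidef.nonneg]
    nth_rw 1 [← hT]
    rw [quad_gram, Matrix.mulVec_mulVec]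
    refine Finset.sum_congr rfl fun i _ => ?_
    rw [← hcoord, Matrix.mulVec_mulVec, hF]
    simp only [Matrix.mul_assoc]
  have hr : quad D.SJbar z = ∑ i, quad D.Sθδ (a i) := by
    have hblock : ∀ i, D.SJ.submatrix (fun a => (a, i)) (fun a => (a, i))
        = (G.submatrix (fun a => (a, i)) id) * D.Sθδ * (G.submatrix (fun a => (a, i)) id)ᵀ := by
      intro i
      have : D.SJ = G * D.Sθδ * Gᵀ := by
        rw [hG, Matrix.transpose_mul]
        simp only [SJ, Matrix.mul_assoc]
        rfl
      rw [this]
      rfl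
    simp only [quad, SJbar, Matrix.sum_mulVec, dotProduct_sum]
    refine Finset.sum_congr rfl fun i _ => ?_
    rw [hblock]
    exact quad_conj _ _ _
  rw [hl, hr]
  refine Finset.sum_le_sum fun i _ => ?_
  have hS := Sθδ_posDef hD
  have h := sq_dotProduct_le_quad_inv_mul_quad hS.inv (a i) (θ - D.θhat)
  rw [Matrix.nonsing_inv_nonsing_inv _ hS.det_pos.ne'.isUnit] at h
  exact h.trans (mul_le_of_le_one_right (quad_nonneg hS.posSemidef _) hθ)

/-- The covariance bound of the robust controller is a robust Lyapunov inequality. -/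
theorem robust_lyapunov (hθ : θ ∈ D.Θδ)
    {X : Matrix (Fin nx ⊕ Fin nx) (Fin nx ⊕ Fin nx) ℝ} {Λ : Matrix (Fin nw) (Fin nw) ℝ}
    (hΛ : Λ.PosDef) (h : (-(D.lmiOuterᵀ * D.lmiMiddle X Λ * D.lmiOuter)).PosDef)
    (g : Fin nx ⊕ Fin nx → ℝ) :
    quad X ((D.calA θ)ᵀ *ᵥ g) + quad (D.calBd * D.calBdᵀ) g ≤ quad X g := by
  set b := D.calBpᵀ *ᵥ g with hb
  -- This is the uncertainty channel of the transposed system: with it, `lmiOuter` sends `(g, q)` to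
  -- a vector containing `(calA θ)ᵀ g`.
  set q := (D.Δ θ)ᵀ *ᵥ b with hq
  have h1 := quad_nonneg h.posSemidef (Sum.elim g q)
  have hA : (D.calA θ)ᵀ *ᵥ g = D.calAhatᵀ *ᵥ g + D.calCqᵀ *ᵥ q := by
    simp only [calA, Matrix.transpose_add, Matrix.transpose_mul, Matrix.add_mulVec, hq, hb,
      Matrix.mulVec_mulVec, Matrix.mul_assoc]
  have hO : D.lmiOuter *ᵥ (Sum.elim g q)
      = Sum.elim (Sum.elim g ((D.calA θ)ᵀ *ᵥ g)) (Sum.elim q g) := by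
    rw [hA, lmiOuter, Matrix.fromRows_mulVec, Matrix.fromBlocks_mulVec, Matrix.fromBlocks_mulVec]
    simp [Sum.elim_comp_inl, Sum.elim_comp_inr]
  rw [quad_neg_left, quad_transpose_conj, hO, lmiMiddle, quad_fromBlocks_diag,
    quad_fromBlocks_diag, quad_fromBlocks_diag, quad_sub_left, quad_neg_left, quad_conj, ← hb, hq,
    transpose_Δ_mulVec, quad_kronecker] at h1
  -- S-procedure: the multiplier terms add up to a nonnegative quantity on the ellipsoid and can be
  -- dropped.
  have h2 : quad Λ b * quad D.Sθδ⁻¹ (θ - D.θhat) ≤ quad Λ b :=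
    mul_le_of_le_one_right (quad_nonneg hΛ.posSemidef b) hθ
  linarith

/-! ### Nominal error -/

/-- Input matrix of the closed loop for the parameter `θ`. -/
def calBν (D : Design nx nu ny nw nθ nε r) (θ : Fin nθ → ℝ) : Matrix (Fin nx ⊕ Fin nx) (Fin nu) ℝ :=
  Matrix.fromRows (D.B θ) 0

theorem calBν_mulVec (ν : Fin nu → ℝ) :
    D.calBν θ *ᵥ ν = D.calBνhat *ᵥ ν
      + (D.calBp * D.Δ θ * D.JΔ) *ᵥ Sum.elim (0 : Fin nx → ℝ) ν := by
  have hB : ∀ θ', Matrix.fromRows (D.B θ') (0 : Matrix (Fin nx) (Fin nu) ℝ) *ᵥ ν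
      = Sum.elim (D.sysMat θ' *ᵥ Sum.elim (0 : Fin nx → ℝ) ν) 0 := by
    intro θ'
    rw [Matrix.fromRows_mulVec, ← Matrix.fromCols_toCols (D.sysMat θ'),
      Matrix.fromCols_mulVec_sumElim]
    simp [B]
  rw [calBν, calBνhat, hB, hB, sysMat_eq, calBp, Matrix.mul_assoc, Matrix.fromRows_mul,
    Matrix.fromRows_mulVec, Matrix.add_mulVec]
  ext (i | i) <;> simp

/-- Expected closed-loop trajectory. -/
def meanTraj (D : Design nx nu ny nw nθ nε r) (θ : Fin nθ → ℝ) (ν : ℕ → Fin nu → ℝ) :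
    ℕ → Fin nx ⊕ Fin nx → ℝ
  | 0 => D.μξ₀
  | t + 1 => D.calA θ *ᵥ meanTraj D θ ν t + D.calBν θ *ᵥ ν t

/-- The true matrix acts on the error, while the parameter mismatch acts on the nominal state and
input. The forcing can thus be bounded by decision variables alone. -/
theorem meanTraj_succ_sub (ν : ℕ → Fin nu → ℝ) (t : ℕ) (ξ : Fin nx ⊕ Fin nx → ℝ) :
    D.meanTraj θ ν (t + 1) - (D.calAhat *ᵥ ξ + D.calBνhat *ᵥ ν t)
      = D.calA θ *ᵥ (D.meanTraj θ ν t - ξ) + (D.calBp * D.Δ θ * D.JΔ) *ᵥ D.xu ξ (ν t) := by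
  have hA : D.calA θ *ᵥ ξ = D.calAhat *ᵥ ξ + (D.calBp * D.Δ θ * D.JΔ) *ᵥ (D.diagIK *ᵥ ξ) := by
    rw [calA, Matrix.add_mulVec, calCq, ← Matrix.mul_assoc, Matrix.mulVec_mulVec]
  rw [meanTraj, calBν_mulVec, Matrix.mulVec_sub, hA, xu, Matrix.mulVec_add]
  abel

/-- Consecutive problems are glued by their initial values, so the first tube step of each problem
is the induction step. -/
theorem wnorm_meanTraj_sub_le (hD : D.Standing) (h2 : D.TubeAssumption) (hθ : θ ∈ D.Θδ)
    {sol : ℕ → MPCVars nx nu} (h : ∀ t, D.IsFeasible t (D.mpcInit sol t) (sol t)) (t : ℕ) :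
    wnorm D.P (D.meanTraj θ (fun s => (sol s).ν 0) t - (sol t).ξ 0) ≤ (sol t).α 0 := by
  have hT : 0 < D.T := hD.T_pos
  induction t with
  | zero =>
    rw [(h 0).init_ξ, (h 0).init_α]
    simp [mpcInit, meanTraj, wnorm_zero]
  | succ t ih =>
    rw [(h (t + 1)).init_ξ, (h (t + 1)).init_α]
    simp only [mpcInit]
    rw [(h t).dynamics 0 hT, meanTraj_succ_sub]
    refine (wnorm_add_le h2.P_posDef.posSemidef _ _).trans (le_trans ?_ ((h t).tube 0 hT))
    refine add_le_add ?_ (wnorm_calBp_mulVec_le hD h2.P_posDef hθ _)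
    exact (wnorm_mulVec_le_of_contraction h2.ρ_mem.1.le (h2.contraction θ hθ) _).trans
      (mul_le_mul_of_nonneg_left ih h2.ρ_mem.1.le)

/-- The expected trajectory satisfies the tightened constraints without the nominal tightening. -/
theorem dotProduct_xu_meanTraj_le (hD : D.Standing) (h2 : D.TubeAssumption) (hθ : θ ∈ D.Θδ)
    {sol : ℕ → MPCVars nx nu} (h : ∀ t, D.IsFeasible t (D.mpcInit sol t) (sol t)) (t : ℕ)
    (j : Fin r) :
    D.h j ⬝ᵥ D.xu (D.meanTraj θ (fun s => (sol s).ν 0) t) ((sol t).ν 0) ≤ 1 - D.c j t := by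
  set m := D.meanTraj θ (fun s => (sol s).ν 0) t
  have h1 := (h t).constraints 0 hD.T_pos j
  have h3 : D.h j ⬝ᵥ D.xu m ((sol t).ν 0)
      = D.h j ⬝ᵥ D.xu ((sol t).ξ 0) ((sol t).ν 0) + (D.diagIKᵀ *ᵥ D.h j) ⬝ᵥ (m - (sol t).ξ 0) := by
    rw [Matrix.mulVec_transpose, ← Matrix.dotProduct_mulVec, ← dotProduct_add, Matrix.mulVec_sub]
    congr 1
    simp only [xu]
    abel
  have h4 := dotProduct_le_wnorm_inv_mul_wnorm h2.P_posDef (D.diagIKᵀ *ᵥ D.h j) (m - (sol t).ξ 0)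
  have h5 : D.f j * wnorm D.P (m - (sol t).ξ 0) ≤ D.f j * (sol t).α 0 :=
    mul_le_mul_of_nonneg_left (wnorm_meanTraj_sub_le hD h2 hθ h t) (wnorm_nonneg _ _)
  rw [add_zero] at h1
  rw [f] at h5 h1
  linarith

/-- The mean is a contraction in the `P`-norm driven by vanishing inputs. -/
theorem tendsto_dotProduct_meanTraj (hD : D.Standing) (h2 : D.TubeAssumption) (hθ : θ ∈ D.Θδ)
    {ν : ℕ → Fin nu → ℝ} (hν : Tendsto (fun t => wnorm D.Rc (ν t)) atTop (𝓝 0))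
    (g : Fin nx ⊕ Fin nx → ℝ) :
    Tendsto (fun t => g ⬝ᵥ D.meanTraj θ ν t) atTop (𝓝 0) := by
  refine tendsto_dotProduct_of_tendsto_wnorm h2.P_posDef ?_ g
  refine tendsto_zero_of_contraction h2.ρ_mem.1.le h2.ρ_mem.2 (fun t => wnorm_nonneg _ _)
    (b := fun t => wnorm D.P (D.calBν θ *ᵥ ν t)) (fun t => ?_) ?_
  · exact (wnorm_add_le h2.P_posDef.posSemidef _ _).trans (add_le_add_left
      (wnorm_mulVec_le_of_contraction h2.ρ_mem.1.le (h2.contraction θ hθ) _) _)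
  · have hν0 : Tendsto ν atTop (𝓝 0) := tendsto_pi_nhds.mpr fun i => by
      simpa using tendsto_dotProduct_of_tendsto_wnorm hD.Rc_posDef hν (Pi.single i 1)
    have hc : Continuous fun x : Fin nu → ℝ => wnorm D.P (D.calBν θ *ᵥ x) :=
      ((continuous_quad D.P).comp (by fun_prop)).sqrt
    simpa [Function.comp_def, wnorm_zero] using (hc.tendsto 0).comp hν0

end Design

end D2PC

namespace D2PC

namespace Design

variable {nx nu ny nw nθ nε r : ℕ} {D : Design nx nu ny nw nθ nε r} {θ : Fin nθ → ℝ}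
  {Qtrue : Matrix (Fin nw) (Fin nw) ℝ} {Rtrue : Matrix (Fin ny) (Fin ny) ℝ}

/-! ### Error covariance -/

/-- Covariance of the disturbance `(E w, L v)` of the closed loop. -/
def noiseCov (D : Design nx nu ny nw nθ nε r) (Qtrue : Matrix (Fin nw) (Fin nw) ℝ)
    (Rtrue : Matrix (Fin ny) (Fin ny) ℝ) : Matrix (Fin nx ⊕ Fin nx) (Fin nx ⊕ Fin nx) ℝ :=
  Matrix.fromBlocks (D.E * Qtrue * D.Eᵀ) 0 0 (D.L * Rtrue * D.Lᵀ)

theorem quad_noiseCov (g : Fin nx ⊕ Fin nx → ℝ) :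
    quad (D.noiseCov Qtrue Rtrue) g
      = quad Qtrue (D.Eᵀ *ᵥ (g ∘ Sum.inl)) + quad Rtrue (D.Lᵀ *ᵥ (g ∘ Sum.inr)) := by
  conv_lhs => rw [← Sum.elim_comp_inl_inr g, noiseCov, quad_fromBlocks_diag, quad_conj, quad_conj]

theorem quad_noiseCov_nonneg (h1 : D.ParameterAssumption θ Qtrue Rtrue)
    (g : Fin nx ⊕ Fin nx → ℝ) : 0 ≤ quad (D.noiseCov Qtrue Rtrue) g := by
  rw [quad_noiseCov]
  exact add_nonneg (quad_nonneg h1.Qtrue_posDef.posSemidef _)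
    (quad_nonneg h1.Rtrue_posDef.posSemidef _)

theorem mul_sqrt_mul_transpose {ι κ : Type*} [Fintype ι] [Fintype κ] [DecidableEq κ]
    (G : Matrix ι κ ℝ) {M : Matrix κ κ ℝ} (hM : M.PosSemidef) :
    G * CFC.sqrt M * (G * CFC.sqrt M)ᵀ = G * M * Gᵀ := by
  have hs : (CFC.sqrt M).IsHermitian :=
    (Matrix.nonneg_iff_posSemidef.mp (CFC.sqrt_nonneg M)).isHermitian
  have hT : (CFC.sqrt M)ᵀ = CFC.sqrt M := by simpa using hs.eq
  rw [Matrix.transpose_mul, hT, Matrix.mul_assoc, ← Matrix.mul_assoc (CFC.sqrt M),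
    CFC.sqrt_mul_sqrt_self M hM.nonneg, Matrix.mul_assoc]

/-- `Q` and `R` dominate positive definite matrices, so their square roots are genuine and `calBd *
calBdᵀ` is the noise covariance built from them. -/
theorem quad_noiseCov_le (h1 : D.ParameterAssumption θ Qtrue Rtrue) (g : Fin nx ⊕ Fin nx → ℝ) :
    quad (D.noiseCov Qtrue Rtrue) g ≤ quad (D.calBd * D.calBdᵀ) g := by
  have hQ : D.Q.PosSemidef := by
    simpa using h1.Q_le.add h1.Qtrue_posDef.posSemidef
  have hR : D.R.PosSemidef := by
    simpa using h1.R_le.add h1.Rtrue_posDef.posSemidef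
  have hB : D.calBd * D.calBdᵀ = D.noiseCov D.Q D.R := by
    rw [calBd, Matrix.fromBlocks_transpose, Matrix.fromBlocks_multiply, noiseCov,
      mul_sqrt_mul_transpose _ hQ, mul_sqrt_mul_transpose _ hR]
    simp
  have h2 := quad_nonneg h1.Q_le (D.Eᵀ *ᵥ (g ∘ Sum.inl))
  have h3 := quad_nonneg h1.R_le (D.Lᵀ *ᵥ (g ∘ Sum.inr))
  rw [quad_sub_left] at h2 h3
  rw [hB, quad_noiseCov, quad_noiseCov]
  linarith

/-- Variance of the component of the stochastic error at time `t` in direction `g`. -/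
def errVar (D : Design nx nu ny nw nθ nε r) (θ : Fin nθ → ℝ) (Qtrue : Matrix (Fin nw) (Fin nw) ℝ)
    (Rtrue : Matrix (Fin ny) (Fin ny) ℝ) (t : ℕ) (g : Fin nx ⊕ Fin nx → ℝ) : ℝ :=
  quad D.Sξ₀ ((D.calA θ ^ t)ᵀ *ᵥ g)
    + ∑ s ∈ Finset.range t, quad (D.noiseCov Qtrue Rtrue) ((D.calA θ ^ s)ᵀ *ᵥ g)

theorem transpose_pow_succ_mulVec {ι : Type*} [Fintype ι] [DecidableEq ι] (A : Matrix ι ι ℝ)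
    (t : ℕ) (g : ι → ℝ) : (A ^ (t + 1))ᵀ *ᵥ g = (A ^ t)ᵀ *ᵥ (Aᵀ *ᵥ g) := by
  rw [pow_succ', Matrix.transpose_mul, Matrix.mulVec_mulVec]

theorem transpose_pow_succ_mulVec' {ι : Type*} [Fintype ι] [DecidableEq ι] (A : Matrix ι ι ℝ)
    (t : ℕ) (g : ι → ℝ) : (A ^ (t + 1))ᵀ *ᵥ g = Aᵀ *ᵥ ((A ^ t)ᵀ *ᵥ g) := by
  rw [pow_succ, Matrix.transpose_mul, Matrix.mulVec_mulVec]

/-- The covariance recursion in dual form: the dynamics act on the direction `g`, so inductions over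
it must vary `g`. -/
theorem errVar_succ (t : ℕ) (g : Fin nx ⊕ Fin nx → ℝ) :
    D.errVar θ Qtrue Rtrue (t + 1) g
      = D.errVar θ Qtrue Rtrue t ((D.calA θ)ᵀ *ᵥ g) + quad (D.noiseCov Qtrue Rtrue) g := by
  simp only [errVar, Finset.sum_range_succ', transpose_pow_succ_mulVec, pow_zero,
    Matrix.transpose_one, Matrix.one_mulVec]
  ring

theorem quad_Sξ₀ (g : Fin nx ⊕ Fin nx → ℝ) : quad D.Sξ₀ g = quad D.Sx₀ (g ∘ Sum.inl) := by
  conv_lhs => rw [← Sum.elim_comp_inl_inr g, Sξ₀, quad_fromBlocks_diag, quad_zero_left, add_zero]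

theorem quad_Sξ₀_nonneg (hD : D.Standing) (g : Fin nx ⊕ Fin nx → ℝ) : 0 ≤ quad D.Sξ₀ g := by
  rw [quad_Sξ₀]
  exact quad_nonneg hD.Sx₀_posSemidef _

theorem errVar_nonneg (hD : D.Standing) (h1 : D.ParameterAssumption θ Qtrue Rtrue) (t : ℕ)
    (g : Fin nx ⊕ Fin nx → ℝ) : 0 ≤ D.errVar θ Qtrue Rtrue t g :=
  add_nonneg (quad_Sξ₀_nonneg hD _) (Finset.sum_nonneg fun _ _ => quad_noiseCov_nonneg h1 _)

theorem errVar_le (hS : D.ErrorCovarianceBound) (h1 : D.ParameterAssumption θ Qtrue Rtrue) (t : ℕ)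
    (g : Fin nx ⊕ Fin nx → ℝ) : D.errVar θ Qtrue Rtrue t g ≤ quad (D.Sbar t) g := by
  induction t generalizing g with
  | zero => simp [errVar, hS.zero]
  | succ t ih =>
    have h := quad_nonneg (hS.succ t θ h1.mem) g
    rw [quad_sub_left, quad_add_left, quad_conj] at h
    rw [errVar_succ]
    linarith [ih ((D.calA θ)ᵀ *ᵥ g), quad_noiseCov_le h1 g]

/-- The Lyapunov inequality contracts powers of `calA`, not of its transpose; each coordinate is
therefore read as the pairing of `g` with `calA ^ t` applied to a basis vector. -/
theorem tendsto_transpose_pow_mulVec (h2 : D.TubeAssumption) (hθ : θ ∈ D.Θδ)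
    (g : Fin nx ⊕ Fin nx → ℝ) :
    Tendsto (fun t => (D.calA θ ^ t)ᵀ *ᵥ g) atTop (𝓝 0) := by
  refine tendsto_pi_nhds.mpr fun i => ?_
  have hw : Tendsto (fun t => wnorm D.P ((D.calA θ ^ t) *ᵥ Pi.single i 1)) atTop (𝓝 0) :=
    tendsto_zero_of_contraction h2.ρ_mem.1.le h2.ρ_mem.2 (fun t => wnorm_nonneg _ _) (b := 0)
      (fun t => by
        rw [pow_succ', ← Matrix.mulVec_mulVec]
        simpa using wnorm_mulVec_le_of_contraction h2.ρ_mem.1.le (h2.contraction θ hθ) _)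
      tendsto_const_nhds
  refine (tendsto_dotProduct_of_tendsto_wnorm h2.P_posDef hw g).congr fun t => ?_
  rw [Matrix.dotProduct_mulVec, ← Matrix.mulVec_transpose]
  simp

/-- Along the orbit of `g` under the transposed dynamics, `X` acts as a storage function dissipating
the noise terms. Their sum is thus at most `quad X g`, and the contribution of the initial
covariance dies out. -/
theorem exists_tendsto_errVar (h1 : D.ParameterAssumption θ Qtrue Rtrue) (h2 : D.TubeAssumption)
    {X : Matrix (Fin nx ⊕ Fin nx) (Fin nx ⊕ Fin nx) ℝ} (hX : X.PosSemidef)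
    (hlyap : ∀ g, quad X ((D.calA θ)ᵀ *ᵥ g) + quad (D.calBd * D.calBdᵀ) g ≤ quad X g)
    (g : Fin nx ⊕ Fin nx → ℝ) :
    ∃ ℓ ≤ quad X g, Tendsto (fun t => D.errVar θ Qtrue Rtrue t g) atTop (𝓝 ℓ) := by
  have hbound : ∀ t, ∑ s ∈ Finset.range t, quad (D.noiseCov Qtrue Rtrue) ((D.calA θ ^ s)ᵀ *ᵥ g)
      + quad X ((D.calA θ ^ t)ᵀ *ᵥ g) ≤ quad X g := by
    intro t
    induction t with
    | zero => simp
    | succ t ih =>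
      rw [Finset.sum_range_succ, transpose_pow_succ_mulVec']
      linarith [hlyap ((D.calA θ ^ t)ᵀ *ᵥ g), quad_noiseCov_le h1 ((D.calA θ ^ t)ᵀ *ᵥ g)]
  have hle := fun t => (le_add_of_nonneg_right (quad_nonneg hX _)).trans (hbound t)
  have hsum := summable_of_sum_range_le (fun s => quad_noiseCov_nonneg h1 _) hle
  have h0 : Tendsto (fun t => quad D.Sξ₀ ((D.calA θ ^ t)ᵀ *ᵥ g)) atTop (𝓝 0) := by
    have := ((continuous_quad D.Sξ₀).tendsto 0).comp (tendsto_transpose_pow_mulVec h2 h1.mem g)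
    rwa [quad_zero_right] at this
  refine ⟨_, Real.tsum_le_of_sum_range_le (fun s => quad_noiseCov_nonneg h1 _) hle, ?_⟩
  simpa only [errVar, zero_add] using h0.add hsum.hasSum.tendsto_sum_nat

/-! ### Stochastic error -/

section Stochastic

variable {Ω' : Type*} {x₀ : Ω' → Fin nx → ℝ} {w : ℕ → Ω' → Fin nw → ℝ} {v : ℕ → Ω' → Fin ny → ℝ}

/-- Deviation of the closed-loop trajectory from its expectation. -/
def errTraj (D : Design nx nu ny nw nθ nε r) (θ : Fin nθ → ℝ) (x₀ : Ω' → Fin nx → ℝ)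
    (w : ℕ → Ω' → Fin nw → ℝ) (v : ℕ → Ω' → Fin ny → ℝ) : ℕ → Ω' → Fin nx ⊕ Fin nx → ℝ
  | 0, ω => Sum.elim (x₀ ω - D.μx₀) 0
  | t + 1, ω => D.calA θ *ᵥ errTraj D θ x₀ w v t ω + Sum.elim (D.E *ᵥ w t ω) (D.L *ᵥ v t ω)

/-- Superposition: both parts obey the recursion with matrix `calA θ`, one driven by the inputs and
one by the noise. -/
theorem IsClosedLoop.eq_add {ν : ℕ → Fin nu → ℝ} {x xc : ℕ → Ω' → Fin nx → ℝ}
    {u : ℕ → Ω' → Fin nu → ℝ} {y : ℕ → Ω' → Fin ny → ℝ}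
    (h : D.IsClosedLoop θ ν x₀ w v x xc u y) (t : ℕ) (ω : Ω') :
    Sum.elim (x t ω) (xc t ω) = D.meanTraj θ ν t + D.errTraj θ x₀ w v t ω := by
  induction t with
  | zero =>
    rw [h.x_zero, h.xc_zero]
    ext (i | i) <;> simp [meanTraj, errTraj, μξ₀]
  | succ t ih =>
    have hA : D.calA θ *ᵥ Sum.elim (x t ω) (xc t ω) = Sum.elim
        (D.A θ *ᵥ x t ω + D.B θ *ᵥ (D.K *ᵥ xc t ω)) (D.L *ᵥ (D.C *ᵥ x t ω) + D.Ac *ᵥ xc t ω) := by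
      rw [calA_eq, Matrix.fromBlocks_mulVec]
      simp [Sum.elim_comp_inl, Sum.elim_comp_inr, Matrix.mulVec_mulVec]
    rw [ih, Matrix.mulVec_add] at hA
    have hstep : D.meanTraj θ ν (t + 1) + D.errTraj θ x₀ w v (t + 1) ω
        = (D.calA θ *ᵥ D.meanTraj θ ν t + D.calA θ *ᵥ D.errTraj θ x₀ w v t ω)
          + D.calBν θ *ᵥ ν t + Sum.elim (D.E *ᵥ w t ω) (D.L *ᵥ v t ω) := by
      rw [meanTraj, errTraj]
      abel
    rw [hstep, hA, h.x_succ, h.xc_succ, h.output, h.input, calBν, Matrix.fromRows_mulVec,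
      Matrix.mulVec_add, Matrix.mulVec_add]
    ext (i | i)
    · simp [add_assoc]
    · simp
      ring

theorem dotProduct_errTraj (t : ℕ) (g : Fin nx ⊕ Fin nx → ℝ) (ω : Ω') :
    g ⬝ᵥ D.errTraj θ x₀ w v t ω
      = ((D.calA θ ^ t)ᵀ *ᵥ g) ⬝ᵥ Sum.elim (x₀ ω - D.μx₀) 0
        + ∑ s ∈ Finset.range t, ((D.calA θ ^ (t - 1 - s))ᵀ *ᵥ g)
            ⬝ᵥ Sum.elim (D.E *ᵥ w s ω) (D.L *ᵥ v s ω) := by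
  induction t generalizing g with
  | zero => simp [errTraj]
  | succ t ih =>
    rw [errTraj, dotProduct_add, Matrix.dotProduct_mulVec, ← Matrix.mulVec_transpose, ih,
      Finset.sum_range_succ, transpose_pow_succ_mulVec, add_assoc]
    congr 2
    · refine Finset.sum_congr rfl fun s hs => ?_
      have hs' := Finset.mem_range.mp hs
      -- Since `s < t`, the truncated subtraction is exact and `(t - 1 - s) + 1 = t - s`.
      rw [← transpose_pow_succ_mulVec]
      congr 4
      omega
    · simp

theorem elim_eq_xu {ν : ℕ → Fin nu → ℝ} {x xc : ℕ → Ω' → Fin nx → ℝ}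
    {u : ℕ → Ω' → Fin nu → ℝ} {y : ℕ → Ω' → Fin ny → ℝ}
    (h : D.IsClosedLoop θ ν x₀ w v x xc u y) (t : ℕ) (ω : Ω') :
    Sum.elim (x t ω) (u t ω) = D.xu (D.meanTraj θ ν t) (ν t)
      + D.diagIK *ᵥ D.errTraj θ x₀ w v t ω := by
  have : Sum.elim (x t ω) (u t ω) = D.xu (Sum.elim (x t ω) (xc t ω)) (ν t) := by
    rw [xu, diagIK, Matrix.fromBlocks_mulVec, h.input]
    ext (i | i) <;> simp [Sum.elim_comp_inl, Sum.elim_comp_inr]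
  rw [this, h.eq_add, xu, xu, Matrix.mulVec_add]
  abel

theorem performanceOutput_eq {ν : ℕ → Fin nu → ℝ} {x xc : ℕ → Ω' → Fin nx → ℝ}
    {u : ℕ → Ω' → Fin nu → ℝ} {y : ℕ → Ω' → Fin ny → ℝ}
    (h : D.IsClosedLoop θ ν x₀ w v x xc u y) (t : ℕ) (ω : Ω') (k : Fin nε) :
    (D.Cε *ᵥ x t ω + D.Dε *ᵥ u t ω) k
      = (D.calCε k ⬝ᵥ D.meanTraj θ ν t + D.Dε k ⬝ᵥ ν t)
        + D.calCε k ⬝ᵥ D.errTraj θ x₀ w v t ω := by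
  have : D.calCε *ᵥ Sum.elim (x t ω) (xc t ω)
      = D.Cε *ᵥ x t ω + D.Dε *ᵥ (D.K *ᵥ xc t ω) := by
    rw [calCε, Matrix.fromCols_mulVec_sumElim, Matrix.mulVec_mulVec]
  have hk := congrFun this k
  rw [h.eq_add, Matrix.mulVec_add] at hk
  rw [h.input, Matrix.mulVec_add, ← add_assoc, Pi.add_apply, ← hk]
  simp only [Pi.add_apply, Matrix.mulVec]
  ring

theorem dotProduct_elim_noise (g : Fin nx ⊕ Fin nx → ℝ) (a : Fin nw → ℝ) (b : Fin ny → ℝ) :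
    g ⬝ᵥ Sum.elim (D.E *ᵥ a) (D.L *ᵥ b)
      = (D.Eᵀ *ᵥ (g ∘ Sum.inl)) ⬝ᵥ a + (D.Lᵀ *ᵥ (g ∘ Sum.inr)) ⬝ᵥ b := by
  rw [Matrix.mulVec_transpose, Matrix.mulVec_transpose, ← Matrix.dotProduct_mulVec,
    ← Matrix.dotProduct_mulVec]
  conv_lhs => rw [← Sum.elim_comp_inl_inr g, sumElim_dotProduct_sumElim]

variable [MeasurableSpace Ω'] {μ : Measure Ω'}

theorem hasLaw_dotProduct_noise (h1 : D.ParameterAssumption θ Qtrue Rtrue)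
    (hn : D.IsNoise μ Qtrue Rtrue x₀ w v) (t : ℕ) (g : Fin nx ⊕ Fin nx → ℝ) :
    HasLaw (fun ω => g ⬝ᵥ Sum.elim (D.E *ᵥ w t ω) (D.L *ᵥ v t ω))
      (gaussianReal 0 (quad (D.noiseCov Qtrue Rtrue) g).toNNReal) μ := by
  simp only [dotProduct_elim_noise, quad_noiseCov]
  have hw := hasLaw_dotProduct_of_multivariateGaussian h1.Qtrue_posDef.posSemidef (m := 0)
    (by simpa using hn.law_w t) (D.Eᵀ *ᵥ (g ∘ Sum.inl))
  have hv := hasLaw_dotProduct_of_multivariateGaussian h1.Rtrue_posDef.posSemidef (m := 0)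
    (by simpa using hn.law_v t) (D.Lᵀ *ᵥ (g ∘ Sum.inr))
  rw [dotProduct_zero] at hw hv
  refine hasLaw_add_gaussian (quad_nonneg h1.Qtrue_posDef.posSemidef _)
    (quad_nonneg h1.Rtrue_posDef.posSemidef _) ?_ hw hv
  exact (hn.indep_wv t).comp (φ := fun a => (D.Eᵀ *ᵥ (g ∘ Sum.inl)) ⬝ᵥ a)
    (ψ := fun b => (D.Lᵀ *ᵥ (g ∘ Sum.inr)) ⬝ᵥ b)
    (by unfold dotProduct; fun_prop) (by unfold dotProduct; fun_prop)

theorem hasLaw_dotProduct_init (hD : D.Standing) (hn : D.IsNoise μ Qtrue Rtrue x₀ w v)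
    (g : Fin nx ⊕ Fin nx → ℝ) :
    HasLaw (fun ω => g ⬝ᵥ Sum.elim (x₀ ω - D.μx₀) 0)
      (gaussianReal 0 (quad D.Sξ₀ g).toNNReal) μ := by
  have h := gaussianReal_sub_const (hasLaw_dotProduct_of_multivariateGaussian hD.Sx₀_posSemidef
    hn.law_x₀ (g ∘ Sum.inl)) ((g ∘ Sum.inl) ⬝ᵥ D.μx₀)
  rw [sub_self, ← quad_Sξ₀] at h
  refine h.congr (.of_forall fun ω => ?_)
  dsimp only
  conv_lhs => rw [← Sum.elim_comp_inl_inr g, sumElim_dotProduct_sumElim, dotProduct_zero, add_zero,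
    dotProduct_sub]

variable [IsProbabilityMeasure μ]

theorem hasLaw_dotProduct_errTraj (hD : D.Standing) (h1 : D.ParameterAssumption θ Qtrue Rtrue)
    (hn : D.IsNoise μ Qtrue Rtrue x₀ w v) (t : ℕ) (g : Fin nx ⊕ Fin nx → ℝ) :
    HasLaw (fun ω => g ⬝ᵥ D.errTraj θ x₀ w v t ω)
      (gaussianReal 0 (D.errVar θ Qtrue Rtrue t g).toNNReal) μ := by
  let G : ℕ → Fin nx ⊕ Fin nx → ℝ := fun s => (D.calA θ ^ (t - 1 - s))ᵀ *ᵥ g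
  let φ : ℕ → (Fin nw → ℝ) × (Fin ny → ℝ) → ℝ :=
    fun s q => G s ⬝ᵥ Sum.elim (D.E *ᵥ q.1) (D.L *ᵥ q.2)
  have hφ : ∀ s, Measurable (φ s) := fun s => by
    simp only [φ, dotProduct_elim_noise]
    unfold dotProduct
    fun_prop
  have hind : iIndepFun (fun s ω => φ s (w s ω, v s ω)) μ := hn.indep_time.comp φ hφ
  have hsum := hasLaw_sum_gaussian (fun s => quad_noiseCov_nonneg h1 (G s)) hind
    (fun s => hasLaw_dotProduct_noise h1 hn s (G s)) t
  have hinit := hasLaw_dotProduct_init hD hn ((D.calA θ ^ t)ᵀ *ᵥ g)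
  -- The initial state is independent of the whole noise sequence, hence of any finite sum formed
  -- from it.
  have hind0 : IndepFun (fun ω => ((D.calA θ ^ t)ᵀ *ᵥ g) ⬝ᵥ Sum.elim (x₀ ω - D.μx₀) 0)
      (∑ s ∈ Finset.range t, fun ω => φ s (w s ω, v s ω)) μ := by
    have h := hn.indep_init.comp
      (φ := fun x => ((D.calA θ ^ t)ᵀ *ᵥ g) ⬝ᵥ Sum.elim (x - D.μx₀) (0 : Fin nx → ℝ))
      (ψ := fun q : ℕ → (Fin nw → ℝ) × (Fin ny → ℝ) => ∑ s ∈ Finset.range t, φ s (q s))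
      (by simp only [dotProduct, Fintype.sum_sum_type, Sum.elim_inl, Sum.elim_inr]; fun_prop)
      (Finset.measurable_sum _ fun s _ => (hφ s).comp (measurable_pi_apply s))
    have he : (∑ s ∈ Finset.range t, fun ω => φ s (w s ω, v s ω))
        = (fun q => ∑ s ∈ Finset.range t, φ s (q s)) ∘ fun ω t => (w t ω, v t ω) :=
      funext fun ω => Finset.sum_apply _ _ _
    rw [he]
    exact h
  have hlaw := hasLaw_add_gaussian (quad_Sξ₀_nonneg hD _)
    (Finset.sum_nonneg fun s _ => quad_noiseCov_nonneg h1 (G s)) hind0 hinit hsum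
  -- The trajectory weights noise `s` by the power `t - 1 - s` and the variance formula uses the
  -- power `s`; reversing the sum reconciles them.
  have hvar : D.errVar θ Qtrue Rtrue t g = quad D.Sξ₀ ((D.calA θ ^ t)ᵀ *ᵥ g)
      + ∑ s ∈ Finset.range t, quad (D.noiseCov Qtrue Rtrue) (G s) := by
    rw [errVar, ← Finset.sum_range_reflect]
  rw [hvar]
  refine hlaw.congr (.of_forall fun ω => ?_)
  simp [dotProduct_errTraj, φ, G]

theorem chance_constraint (hD : D.Standing) (hS : D.ErrorCovarianceBound)
    (h1 : D.ParameterAssumption θ Qtrue Rtrue) (h2 : D.TubeAssumption)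
    (hn : D.IsNoise μ Qtrue Rtrue x₀ w v) {sol : ℕ → MPCVars nx nu}
    (hsol : ∀ t, D.IsFeasible t (D.mpcInit sol t) (sol t)) {x xc : ℕ → Ω' → Fin nx → ℝ}
    {u : ℕ → Ω' → Fin nu → ℝ} {y : ℕ → Ω' → Fin ny → ℝ}
    (h : D.IsClosedLoop θ (fun t => (sol t).ν 0) x₀ w v x xc u y) (t : ℕ) (j : Fin r)
    (hp : 1 / 2 ≤ D.p j) :
    D.p j ≤ μ.real {ω | D.h j ⬝ᵥ Sum.elim (x t ω) (u t ω) ≤ 1} := by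
  set g := D.diagIKᵀ *ᵥ D.h j with hg
  -- Replacing the variance by its upper bound is conservative only for a nonnegative quantile; this
  -- is where `1 / 2 ≤ p` enters.
  have hb : quantile (gaussianReal 0 1) (D.p j) * √(D.errVar θ Qtrue Rtrue t g) ≤ D.c j t :=
    mul_le_mul_of_nonneg_left (Real.sqrt_le_sqrt (errVar_le hS h1 t g))
      (quantile_gaussianReal_nonneg hp (hD.p_mem j).2)
  refine (le_measureReal_gaussian_le (errVar_nonneg hD h1 t g)
    (hasLaw_dotProduct_errTraj hD h1 hn t g) (hD.p_mem j).1 (hD.p_mem j).2 hb).trans ?_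
  refine measureReal_mono fun ω hω => ?_
  have hm := dotProduct_xu_meanTraj_le hD h2 h1.mem hsol t j
  simp only [Set.mem_ofPred_eq, elim_eq_xu h, dotProduct_add] at hω ⊢
  rw [hg, Matrix.mulVec_transpose, ← Matrix.dotProduct_mulVec] at hω
  linarith

/-! ### Average cost -/

/-- The cross weight vanishes, so the stage cost is the squared norm of the performance output and
can be treated one Gaussian coordinate at a time. -/
theorem stageCost_eq (hD : D.Standing) (a : Fin nx → ℝ) (b : Fin nu → ℝ) :
    quad D.Qc a + quad D.Rc b = ∑ k, (D.Cε *ᵥ a + D.Dε *ᵥ b) k ^ 2 := by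
  have hcross : ∑ k, (D.Cε *ᵥ a) k * (D.Dε *ᵥ b) k = 0 := by
    change (D.Cε *ᵥ a) ⬝ᵥ (D.Dε *ᵥ b) = 0
    rw [← Matrix.vecMul_transpose, ← Matrix.dotProduct_mulVec, Matrix.mulVec_mulVec, hD.cross_eq,
      Matrix.zero_mulVec, dotProduct_zero]
  rw [← hD.Qc_eq, ← hD.Rc_eq, quad_gram, quad_gram]
  simp only [Pi.add_apply, add_sq, Finset.sum_add_distrib, mul_assoc, ← Finset.mul_sum, hcross]
  ring

theorem integrable_stageCost_and_integral (hD : D.Standing)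
    (h1 : D.ParameterAssumption θ Qtrue Rtrue) (hn : D.IsNoise μ Qtrue Rtrue x₀ w v)
    {ν : ℕ → Fin nu → ℝ} {x xc : ℕ → Ω' → Fin nx → ℝ}
    {u : ℕ → Ω' → Fin nu → ℝ} {y : ℕ → Ω' → Fin ny → ℝ}
    (h : D.IsClosedLoop θ ν x₀ w v x xc u y) (t : ℕ) :
    Integrable (fun ω => quad D.Qc (x t ω) + quad D.Rc (u t ω)) μ ∧
      ∫ ω, (quad D.Qc (x t ω) + quad D.Rc (u t ω)) ∂μ
        = ∑ k, ((D.calCε k ⬝ᵥ D.meanTraj θ ν t + D.Dε k ⬝ᵥ ν t) ^ 2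
          + D.errVar θ Qtrue Rtrue t (D.calCε k)) := by
  simp only [stageCost_eq hD, performanceOutput_eq h]
  have hk := fun k => integrable_sq_add_and_integral (errVar_nonneg hD h1 t (D.calCε k))
    (hasLaw_dotProduct_errTraj hD h1 hn t (D.calCε k))
    (D.calCε k ⬝ᵥ D.meanTraj θ ν t + D.Dε k ⬝ᵥ ν t)
  refine ⟨integrable_finsetSum _ fun k _ => (hk k).1, ?_⟩
  rw [integral_finsetSum _ fun k _ => (hk k).1]
  exact Finset.sum_congr rfl fun k _ => (hk k).2

end Stochastic

end Design

end D2PC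

/-! ### The closed-loop guarantees -/

open D2PC D2PC.Design in
theorem mainTheorem1 {nx nu ny nw nθ nε r : ℕ} (D : D2PC.Design nx nu ny nw nθ nε r)
    (hD : D.Standing) (hS : D.ErrorCovarianceBound)
    (θ : Fin nθ → ℝ) (Qtrue : Matrix (Fin nw) (Fin nw) ℝ) (Rtrue : Matrix (Fin ny) (Fin ny) ℝ)
    (h1 : D.ParameterAssumption θ Qtrue Rtrue) (h2 : D.TubeAssumption)
    (h3 : D.TerminalAssumption)
    (h0 : ∃ m, D.IsFeasible 0 (D.μξ₀, 0) m)
    (γ : ℝ) (hγ : D.RobustControllerCondition γ)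
    {Ω' : Type*} [MeasurableSpace Ω'] (μ : Measure Ω') [IsProbabilityMeasure μ]
    (x₀ : Ω' → Fin nx → ℝ) (w : ℕ → Ω' → Fin nw → ℝ) (v : ℕ → Ω' → Fin ny → ℝ)
    (hnoise : D.IsNoise μ Qtrue Rtrue x₀ w v) :
    (∀ (t : ℕ) (sol : ℕ → D2PC.MPCVars nx nu),
      (∀ s < t, D.IsOptimal s (D.mpcInit sol s) (sol s)) →
        ∃ m, D.IsFeasible t (D.mpcInit sol t) m) ∧
    ∀ sol : ℕ → D2PC.MPCVars nx nu,
      (∀ t, D.IsOptimal t (D.mpcInit sol t) (sol t)) →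
      ∀ (x xc : ℕ → Ω' → Fin nx → ℝ) (u : ℕ → Ω' → Fin nu → ℝ) (y : ℕ → Ω' → Fin ny → ℝ),
        D.IsClosedLoop θ (fun t => (sol t).ν 0) x₀ w v x xc u y →
        (∀ t j, 1 / 2 ≤ D.p j →
          D.p j ≤ μ.real {ω | D.h j ⬝ᵥ Sum.elim (x t ω) (u t ω) ≤ 1}) ∧
        (∀ t, Integrable (fun ω => D2PC.quad D.Qc (x t ω) + D2PC.quad D.Rc (u t ω)) μ) ∧
        ∃ ℓ ≤ γ ^ 2, Tendsto
          (fun N : ℕ => (1 / (N : ℝ)) * ∫ ω, ∑ t ∈ Finset.range N,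
            (D2PC.quad D.Qc (x t ω) + D2PC.quad D.Rc (u t ω)) ∂μ)
          atTop (𝓝 ℓ) := by

  refine ⟨fun t sol hsol => ?_, fun sol hsol x xc u y hcl => ⟨fun t j hp => ?_, fun t => ?_, ?_⟩⟩
  · cases t with
    | zero => exact h0
    | succ t => exact ⟨_, isFeasible_shift_sol hD h3 (hsol t t.lt_succ_self).1⟩
  · exact chance_constraint hD hS h1 h2 hnoise (fun t => (hsol t).1) hcl t j hp
  · exact (integrable_stageCost_and_integral hD h1 hnoise hcl t).1
  obtain ⟨-, X, Λ, hX, hΛ, htr, hlmi⟩ := hγ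
  choose ℓ hℓ hlim using fun k => exists_tendsto_errVar h1 h2 hX.posSemidef
    (robust_lyapunov h1.mem hΛ hlmi) (D.calCε k)
  have hν := tendsto_wnorm_ν hD h3 hsol
  have hstage : Tendsto (fun t => ∫ ω, (quad D.Qc (x t ω) + quad D.Rc (u t ω)) ∂μ) atTop
      (𝓝 (∑ k, ℓ k)) := by
    simp only [fun t => (integrable_stageCost_and_integral hD h1 hnoise hcl t).2]
    refine tendsto_finsetSum _ fun k _ => ?_
    -- The squared mean of each output vanishes in the limit, leaving only its limiting variance `ℓ
    -- k`.
    have h := (((tendsto_dotProduct_meanTraj hD h2 h1.mem hν (D.calCε k)).add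
      (tendsto_dotProduct_of_tendsto_wnorm hD.Rc_posDef hν (D.Dε k))).pow 2).add (hlim k)
    simpa using h
  refine ⟨∑ k, ℓ k, ?_, hstage.cesaro.congr fun N => ?_⟩
  · rw [trace_conj_eq_sum_quad] at htr
    exact (Finset.sum_le_sum fun k _ => hℓ k).trans htr
  · rw [one_div, integral_finsetSum _ fun t _ =>
      (integrable_stageCost_and_integral hD h1 hnoise hcl t).1]
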